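/- For a permutation $\pi$ in one-line notation, let $s(\pi)$ be the output of West's stack-sorting map: read the entries of $\pi$ from left to right; whenever there is a next input entry and it is smaller than the entry at the top of the stack, or the stack is empty, push that entry onto the stack; otherwise, pop the top entry of the stack and append it to the output; stop when all entries have been output. Let $\mathcal W_3(n)$ be the set of permutations $\sigma$ of $\{1,\dots,n\}$ such that $s(s(s(\sigma)))$ is increasing ($3$-stack-sortable permutations), and let $\operatorname{des}(\sigma)$ be the number of indices $i\in\{1,\dots,n-1\}$ with $\sigma_i>\sigma_{i+1}$. Then for every integer $n$ with $0\le n\le 43$, all complex roots of the polynomial $$\sum_{\sigma\in\mathcal W_3(n)}x^{\operatorname{des}(\sigma)}$$ are real. -/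

import Mathlib

/-- The procedure behind West's stack-sorting map, run on the current stack (head = top of the stack)
and the remaining input; the result is the list of entries that are still to be output. If the next
input entry is smaller than the top of the stack, or the stack is empty, that entry is pushed;
otherwise the top of the stack is appended to the output. -/
def stackRun : List ℕ → List ℕ → List ℕ
  | [], [] => []
  | [], x :: input => stackRun [x] input
  | a :: stack, [] => a :: stackRun stack []
  | a :: stack, x :: input =>
      if x < a then stackRun (x :: a :: stack) input
      else a :: stackRun stack (x :: input)
  termination_by stack input => stack.length + 2 * input.length

/-- West's stack-sorting map `s`, on words in one-line notation. -/
def stackSort (π : List ℕ) : List ℕ := stackRun [] π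

/-- The number of descents of `π = π₀ π₁ ⋯ πₘ₋₁`: the indices `i` with `i + 1 < m`
and `πᵢ > πᵢ₊₁`. -/
def des (π : List ℕ) : ℕ :=
  ((Finset.range (π.length - 1)).filter fun i => π.getD i 0 > π.getD (i + 1) 0).card

/-- `Sₙ`: the permutations of `1, …, n` in one-line notation. -/
def permWords (n : ℕ) : Finset (List ℕ) := (List.range' 1 n).permutations.toFinset

/-- The set `𝒲ₜ(n)` of `t`-stack-sortable permutations in `Sₙ`: those `π` for which the `t`-fold
iterate `sᵗ(π)` is increasing. -/
def stackSortable (t n : ℕ) : Finset (List ℕ) :=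
  (permWords n).filter fun π => (stackSort^[t] π).Pairwise (· < ·)

/-- The descent polynomial `∑_{σ ∈ 𝒲ₜ(n)} x ^ des σ`. -/
noncomputable def descentPoly (t n : ℕ) : Polynomial ℝ :=
  ∑ σ ∈ stackSortable t n, Polynomial.X ^ des σ

/-- A real polynomial is real-rooted if all of its complex roots are real. (The zero polynomial,
which vanishes everywhere on `ℂ`, is not real-rooted.) -/
def RealRooted (p : Polynomial ℝ) : Prop :=
  ∀ z : ℂ, Polynomial.aeval z p = 0 → z.im = 0

/-! Reading a decreasing binary tree in inorder gives a word `σ`, and every word with distinct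
letters arises once. Since `s(L m R) = s(L) s(R) m`, the word `s(σ)` is the postorder of the same
tree, and `des σ` is the number of nodes with a right child. Hence the descent polynomial of `𝒲₃(n)`
is the sum over `τ ∈ 𝒲₂(n)` of the weighted count `treeSum 1 x x τ` of the trees with postorder `τ`
(`sum_stackSortPreimage`, `aeval_descentPoly`).

Moving an only child to the other side does not change the postorder, so only `α + β` and `x`
matter; and a tree on `n` nodes has `n - 1` edges, two at each two-child node. The polynomial is
therefore `(1 + x) ^ (n - 1) * γₙ(x / (1 + x) ^ 2)`, where `γₙ` (`gammaPoly`) has natural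
coefficients and degree at most `(n - 1) / 2` (`aeval_descentPoly_eq_gammaPoly`). As `z / (1 + z) ^
2` is a negative real only for real `z`, it suffices that all roots of `γₙ` are negative reals.

For `n ≤ 43` this is a finite computation, made feasible by a polynomial-time recurrence
(`sortSeries_succ`). A word of `𝒲₂` splits at its maximum into two smaller ones plus an
interleaving, chosen among the cuts of the right part; marking cuts by `1 + X` turns the choice into
a shift of coefficients. The tree count factors along the same splitting once words followed by an
increasing run of `l` large letters are admitted (`treeSum_decomposition`).

The recurrence is run in the kernel on natural numbers whose digits pack the dependence on `l`
(`gammaValues_eq`). The base-`B` digits of `γₙ(B)` are the coefficients of `γₙ`, and enough sign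
changes on the negative axis exhibit all roots (`rootCheck_spec`). -/

/-! ### The stack-sorting map: recursion at the maximum and invariance under relabelling. -/

theorem stackRun_append_bottom (m : ℕ) (st inp : List ℕ) (h : ∀ v ∈ inp, v < m) :
    stackRun (st ++ [m]) inp = stackRun st inp ++ [m] := by
  fun_induction stackRun st inp with
  | case1 => simp [stackRun]
  | case2 x inp ih =>
    have hx : x < m := h x (by simp)
    have := ih (fun v hv => h v (by simp [hv]))
    simp only [List.nil_append, List.cons_append] at this ⊢
    rw [← this, stackRun, if_pos hx]
  | case3 a st ih =>
    have := ih h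
    simp only [List.cons_append]
    rw [stackRun, this]
  | case4 a st x inp hlt ih =>
    have := ih (fun v hv => h v (by simp [hv]))
    simp only [List.cons_append] at this ⊢
    rw [stackRun, if_pos hlt, this]
  | case5 a st x inp hlt ih =>
    have := ih h
    simp only [List.cons_append] at this ⊢
    rw [stackRun, if_neg hlt, this]

/-- A letter exceeding the whole stack forces every pop before it is pushed, so the part before it
is output completely. -/
theorem stackRun_append_max (m : ℕ) (R st L : List ℕ) (hst : ∀ v ∈ st, v < m)
    (hL : ∀ v ∈ L, v < m) :
    stackRun st (L ++ m :: R) = stackRun st L ++ stackRun [m] R := by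
  fun_induction stackRun st L with
  | case1 => simp [stackRun]
  | case2 x inp ih =>
    have := ih (by simpa using hL x (by simp)) (fun v hv => hL v (by simp [hv]))
    simp only [List.cons_append]
    rw [stackRun, this]
  | case3 a st ih =>
    have := ih (fun v hv => hst v (by simp [hv])) hL
    have ha : a < m := hst a (by simp)
    simp only [List.nil_append, List.cons_append] at this ⊢
    rw [stackRun, if_neg (by omega), this]
  | case4 a st x inp hlt ih =>
    have := ih (by
      intro v hv
      rcases List.mem_cons.1 hv with rfl | hv
      · exact hL v (by simp)
      · exact hst v hv) (fun v hv => hL v (by simp [hv]))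
    simp only [List.cons_append] at this ⊢
    rw [stackRun, if_pos hlt, this]
  | case5 a st x inp hlt ih =>
    have := ih (fun v hv => hst v (by simp [hv])) hL
    simp only [List.cons_append] at this ⊢
    rw [stackRun, if_neg hlt, this]

@[simp] theorem stackSort_nil : stackSort [] = [] := by simp [stackSort, stackRun]

theorem stackSort_append_max {m : ℕ} {L R : List ℕ} (hL : ∀ v ∈ L, v < m) (hR : ∀ v ∈ R, v < m) :
    stackSort (L ++ m :: R) = stackSort L ++ stackSort R ++ [m] := by
  rw [stackSort, stackRun_append_max m R [] L (by simp) hL]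
  have := stackRun_append_bottom m [] R hR
  simp only [List.nil_append] at this
  rw [this, stackSort, stackSort, List.append_assoc]

theorem stackRun_perm (st inp : List ℕ) : (stackRun st inp).Perm (st ++ inp) := by
  fun_induction stackRun st inp with
  | case1 => simp
  | case2 x inp ih => simpa using ih
  | case3 a st ih => simpa using ih
  | case4 a st x inp hlt ih =>
    refine ih.trans ?_
    simpa using (List.perm_middle (a := x) (l₁ := a :: st) (l₂ := inp)).symm
  | case5 a st x inp hlt ih => simpa using ih

theorem stackSort_perm (π : List ℕ) : (stackSort π).Perm π := by
  simpa [stackSort] using stackRun_perm [] π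

/-- The procedure only compares letters, so it sees nothing but their relative order. -/
theorem stackRun_map (g : ℕ → ℕ) (st inp : List ℕ)
    (h : ∀ a ∈ st ++ inp, ∀ b ∈ st ++ inp, (g a < g b ↔ a < b)) :
    stackRun (st.map g) (inp.map g) = (stackRun st inp).map g := by
  fun_induction stackRun st inp with
  | case1 => simp [stackRun]
  | case2 x inp ih =>
    have := ih (by simpa using h)
    simp only [List.map_cons, List.map_nil] at this ⊢
    rw [stackRun, this]
  | case3 a st ih =>
    have := ih (fun u hu v hv => h u (by simp_all) v (by simp_all))
    simp only [List.map_cons, List.map_nil] at this ⊢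
    rw [stackRun, this]
  | case4 a st x inp hlt ih =>
    have := ih (fun u hu v hv => h u (by simp at hu ⊢; tauto) v (by simp at hv ⊢; tauto))
    simp only [List.map_cons] at this ⊢
    rw [stackRun, if_pos ((h x (by simp) a (by simp)).2 hlt), this]
  | case5 a st x inp hlt ih =>
    have := ih (fun u hu v hv => h u (by simp at hu ⊢; tauto) v (by simp at hv ⊢; tauto))
    simp only [List.map_cons] at this ⊢
    rw [stackRun, if_neg (fun hh => hlt ((h x (by simp) a (by simp)).1 hh)), this]

theorem stackSort_map (g : ℕ → ℕ) (π : List ℕ)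
    (h : ∀ a ∈ π, ∀ b ∈ π, (g a < g b ↔ a < b)) :
    stackSort (π.map g) = (stackSort π).map g := by
  simpa [stackSort] using stackRun_map g [] π (by simpa using h)

theorem exists_eq_append_max (π : List ℕ) (hπ : π ≠ []) (hd : π.Nodup) :
    ∃ L m R, π = L ++ m :: R ∧ (∀ v ∈ L, v < m) ∧ (∀ v ∈ R, v < m) := by
  obtain ⟨m, hm⟩ : ∃ m, m ∈ π ∧ ∀ v ∈ π, v ≤ m := by
    obtain ⟨m, hm, h⟩ := Finset.exists_max_image π.toFinset id
      (by simpa [Finset.nonempty_iff_ne_empty] using hπ)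
    exact ⟨m, by simpa using hm, fun v hv => h v (by simpa using hv)⟩
  obtain ⟨L, R, rfl⟩ := List.append_of_mem hm.1
  refine ⟨L, m, R, rfl, fun v hv => ?_, fun v hv => ?_⟩
  · refine lt_of_le_of_ne (hm.2 v (by simp [hv])) ?_
    rintro rfl
    simp [List.nodup_append] at hd
    exact (hd.2.2 v hv).1 rfl
  · refine lt_of_le_of_ne (hm.2 v (by simp [hv])) ?_
    rintro rfl
    simp [List.nodup_append] at hd
    exact hd.2.1.1 hv

theorem append_max_induction {P : List ℕ → Prop} (nil : P [])
    (step : ∀ (L : List ℕ) (m : ℕ) (R : List ℕ), (L ++ m :: R).Nodup → (∀ v ∈ L, v < m) →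
      (∀ v ∈ R, v < m) → P L → P R → P (L ++ m :: R)) (π : List ℕ) (hd : π.Nodup) : P π := by
  induction hn : π.length using Nat.strong_induction_on generalizing π with
  | _ n ih =>
    by_cases hπ : π = []
    · exact hπ ▸ nil
    · obtain ⟨L, m, R, rfl, hL, hR⟩ := exists_eq_append_max π hπ hd
      have hd' := List.nodup_append.1 hd
      refine step L m R hd hL hR (ih L.length ?_ L hd'.1 rfl)
        (ih R.length ?_ R (List.nodup_cons.1 hd'.2.1).2 rfl)
      · simp at hn; omega
      · simp at hn; omega

/-! ### Descents and the maximum. -/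

theorem des_nil : des [] = 0 := by simp [des]

theorem des_singleton (a : ℕ) : des [a] = 0 := by simp [des]

theorem des_cons_cons (a b : ℕ) (l : List ℕ) :
    des (a :: b :: l) = (if b < a then 1 else 0) + des (b :: l) := by
  simp only [des, List.length_cons, Nat.add_sub_cancel, Finset.card_filter]
  rw [Finset.sum_range_succ']
  simp only [List.getD_cons_succ, List.getD_cons_zero, gt_iff_lt]
  exact add_comm _ _

theorem des_append_cons (L : List ℕ) (m : ℕ) (R : List ℕ) (hL : ∀ v ∈ L, v < m) :
    des (L ++ m :: R) = des L + des (m :: R) := by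
  induction L with
  | nil => simp [des_nil]
  | cons a L ih =>
    have ih := ih (fun v hv => hL v (by simp [hv]))
    cases L with
    | nil =>
      have := hL a (by simp)
      simp [des_cons_cons, des_singleton, Nat.not_lt.2 this.le]
    | cons b L =>
      simp only [List.cons_append, des_cons_cons] at ih ⊢
      omega

/-- With `m` as the root of a binary tree and `L`, `R` as its subtrees, this makes `des` the number
of nodes that have a right child. -/
theorem des_append_max (L : List ℕ) (m : ℕ) (R : List ℕ) (hL : ∀ v ∈ L, v < m)
    (hR : ∀ v ∈ R, v < m) :
    des (L ++ m :: R) = des L + des R + if R = [] then 0 else 1 := by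
  rw [des_append_cons L m R hL]
  cases R with
  | nil => simp [des_singleton, des_nil]
  | cons b R =>
    have := hR b (by simp)
    simp [des_cons_cons, this]
    omega

/-! ### Weighted counts of decreasing binary trees by postorder. -/

open Finset in
/-- The sum of `g p q` over the factorizations `l = p ++ q`. -/
def splitSum {R : Type*} [AddCommMonoid R] (g : List ℕ → List ℕ → R) (l : List ℕ) : R :=
  ∑ i ∈ range (l.length + 1), g (l.take i) (l.drop i)

section
variable {R : Type*} [CommSemiring R]

/-- The weight of a node of a binary tree, given the postorder words of its two subtrees:
`α` for a left child only, `β` for a right child only, `x` for two children. -/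
def nodeWeight (α β x : R) (p q : List ℕ) : R :=
  if p = [] then (if q = [] then 1 else β) else (if q = [] then α else x)

/-- The total weight of the decreasing binary trees with postorder word `τ`. -/
def treeSum (α β x : R) : List ℕ → R
  | [] => 1
  | v :: l =>
    let M := (v :: l).getLast (by simp)
    let p := (v :: l).dropLast
    if ∀ u ∈ p, u < M then
      ∑ i ∈ Finset.range (p.length + 1),
        nodeWeight α β x (p.take i) (p.drop i) * treeSum α β x (p.take i) *
          treeSum α β x (p.drop i)
    else 0
  termination_by τ => τ.length
  decreasing_by
    all_goals simp; try omega

variable (α β x : R)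

@[simp] theorem treeSum_nil : treeSum α β x [] = 1 := by simp [treeSum]

theorem treeSum_append_singleton (p : List ℕ) (M : ℕ) :
    treeSum α β x (p ++ [M]) = if ∀ u ∈ p, u < M then
      splitSum (fun q r => nodeWeight α β x q r * treeSum α β x q * treeSum α β x r) p else 0 := by
  obtain ⟨v, l, h⟩ : ∃ v l, p ++ [M] = v :: l := by
    cases p <;> simp
  have h1 : (v :: l).dropLast = p := by rw [← h]; simp
  have h2 : (v :: l).getLast (by simp) = M := by simp [← h]
  rw [h, treeSum]
  simp only [h1, h2, splitSum]

theorem treeSum_append_singleton_of_lt {p : List ℕ} {M : ℕ} (h : ∀ u ∈ p, u < M) :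
    treeSum α β x (p ++ [M]) =
      splitSum (fun q r => nodeWeight α β x q r * treeSum α β x q * treeSum α β x r) p := by
  rw [treeSum_append_singleton, if_pos h]

theorem treeSum_eq_zero {p : List ℕ} {M u : ℕ} (hu : u ∈ p) (h : M ≤ u) :
    treeSum α β x (p ++ [M]) = 0 := by
  rw [treeSum_append_singleton, if_neg]
  exact fun h' => absurd (h' u hu) (by omega)

theorem treeSum_singleton (m : ℕ) : treeSum α β x [m] = 1 := by
  have := treeSum_append_singleton α β x [] m
  simpa [splitSum, nodeWeight] using this

theorem splitSum_append {R : Type*} [AddCommMonoid R] (g : List ℕ → List ℕ → R) (l₁ l₂ : List ℕ) :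
    splitSum g (l₁ ++ l₂) = (∑ i ∈ Finset.range l₁.length, g (l₁.take i) (l₁.drop i ++ l₂)) +
      splitSum (fun p q => g (l₁ ++ p) q) l₂ := by
  rw [splitSum, List.length_append, add_assoc, Finset.sum_range_add, splitSum]
  congr 1
  · refine Finset.sum_congr rfl fun i hi => ?_
    have hi := Finset.mem_range.1 hi
    rw [List.take_append_of_le_length hi.le, List.drop_append_of_le_length hi.le]
  · refine Finset.sum_congr rfl fun i hi => ?_
    rw [List.take_length_add_append, List.drop_length_add_append]

theorem splitSum_cons {R : Type*} [AddCommMonoid R] (g : List ℕ → List ℕ → R) (a : ℕ)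
    (l : List ℕ) :
    splitSum g (a :: l) = g [] (a :: l) + splitSum (fun p q => g (a :: p) q) l := by
  simpa using splitSum_append g [a] l

theorem map_treeSum {S : Type*} [CommSemiring S] (φ : R →+* S) (τ : List ℕ) :
    φ (treeSum α β x τ) = treeSum (φ α) (φ β) (φ x) τ := by
  induction hn : τ.length using Nat.strong_induction_on generalizing τ with
  | _ n ih =>
    rcases List.eq_nil_or_concat τ with rfl | ⟨p, M, rfl⟩
    · simp
    · rw [List.concat_eq_append, treeSum_append_singleton, treeSum_append_singleton]
      rw [List.concat_eq_append, List.length_append, List.length_singleton] at hn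
      split_ifs with h
      · rw [splitSum, splitSum, map_sum]
        refine Finset.sum_congr rfl fun i _ => ?_
        rw [map_mul, map_mul, ih _ (by simp; omega) _ rfl, ih _ (by simp; omega) _ rfl]
        congr 2
        unfold nodeWeight
        split_ifs <;> simp
      · simp

theorem treeSum_map (g : ℕ → ℕ) (τ : List ℕ) (h : ∀ a ∈ τ, ∀ b ∈ τ, (g a < g b ↔ a < b)) :
    treeSum α β x (τ.map g) = treeSum α β x τ := by
  induction hn : τ.length using Nat.strong_induction_on generalizing τ with
  | _ n ih =>
    rcases List.eq_nil_or_concat τ with rfl | ⟨p, M, rfl⟩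
    · simp
    · rw [List.concat_eq_append] at hn h ⊢
      rw [List.map_append, List.map_singleton, treeSum_append_singleton, treeSum_append_singleton]
      rw [List.length_append, List.length_singleton] at hn
      have hc : (∀ u ∈ p.map g, u < g M) ↔ ∀ u ∈ p, u < M := by
        simp only [List.mem_map, forall_exists_index, and_imp, forall_apply_eq_imp_iff₂]
        exact forall₂_congr fun u hu => h u (by simp [hu]) M (by simp)
      simp only [hc]
      congr 1
      rw [splitSum, splitSum, List.length_map]
      refine Finset.sum_congr rfl fun i _ => ?_
      rw [← List.map_take, ← List.map_drop, ih _ (by simp; omega) _ ?_ rfl,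
        ih _ (by simp; omega) _ ?_ rfl]
      · congr 2
        simp [nodeWeight]
      · exact fun a ha b hb => h a (by simp [List.mem_of_mem_drop ha]) b
          (by simp [List.mem_of_mem_drop hb])
      · exact fun a ha b hb => h a (by simp [List.mem_of_mem_take ha]) b
          (by simp [List.mem_of_mem_take hb])

theorem nodeWeight_ne_nil {p q : List ℕ} (hp : p ≠ []) (hq : q ≠ []) :
    nodeWeight α β x p q = x := by simp [nodeWeight, hp, hq]

theorem splitSum_append_cons {R : Type*} [AddCommMonoid R] (g : List ℕ → List ℕ → R)
    (A : List ℕ) (m : ℕ) (C : List ℕ) :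
    splitSum g (A ++ m :: C) =
      (∑ i ∈ Finset.range (A.length + 1), g (A.take i) (A.drop i ++ m :: C)) +
      splitSum (fun p q => g (A ++ m :: p) q) C := by
  rw [splitSum_append, splitSum_cons, Finset.sum_range_succ]
  simp [add_assoc]

/-- The root is the last letter of a postorder, so that letter must be the maximum. -/
theorem treeSum_append_cons_append_eq_zero {m : ℕ} {B : List ℕ} (hB : B ≠ [])
    (hBm : ∀ v ∈ B, v < m) (A : List ℕ) : treeSum α β x (A ++ m :: B) = 0 := by
  have h : A ++ m :: B = (A ++ m :: B.dropLast) ++ [B.getLast hB] := by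
    simp [List.dropLast_append_getLast]
  rw [h]
  exact treeSum_eq_zero α β x (u := m) (by simp) (hBm _ (List.getLast_mem hB)).le

/-- The decomposition of the trees at the parent of a node `m` that is followed by a smaller
entry, when only a final increasing run `t` of the word exceeds `m`. -/
theorem treeSum_decomposition {m : ℕ} {B : List ℕ} (hB : B ≠ []) (hBm : ∀ v ∈ B, v < m)
    (t : List ℕ) (A : List ℕ) (hAm : ∀ v ∈ A, v < m) (ht : t.Pairwise (· < ·))
    (hmt : ∀ v ∈ t, m < v) :
    treeSum α β x (A ++ m :: (B ++ t)) = x * ∑ j ∈ Finset.range t.length,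
      treeSum α β x (A ++ m :: t.drop (j + 1)) * treeSum α β x (B ++ t.take j) := by
  -- Combinatorially: the letter after `m` is smaller, so it is not the parent of `m`. Hence `m` is
  -- a left child with a sibling, and its parent is some letter of `t`, say the one at index `j`.
  -- The sibling's subtree has postorder `B ++ t.take j`. Contracting the parent and that subtree
  -- into `m` leaves a tree with postorder `A ++ m :: t.drop (j + 1)` and loses exactly the weight
  -- `x`. The induction carries this out by splitting at the root `M`, the last letter of `t`.
  induction hn : t.length using Nat.strong_induction_on generalizing t A with
  | _ n ih =>
    rcases List.eq_nil_or_concat t with rfl | ⟨t', M, rfl⟩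
    · obtain rfl : 0 = n := by simpa using hn
      simpa using treeSum_append_cons_append_eq_zero α β x hB hBm A
    · rw [List.concat_eq_append] at hn ht hmt ⊢
      obtain rfl : n = t'.length + 1 := by simpa using hn.symm
      have ht' : t'.Pairwise (· < ·) := (List.pairwise_append.1 ht).1
      have htM : ∀ v ∈ t', v < M := fun v hv => (List.pairwise_append.1 ht).2.2 v hv M (by simp)
      have hmt' : ∀ v ∈ t', m < v := fun v hv => hmt v (by simp [hv])
      have hmM : m < M := hmt M (by simp)
      have hlt : ∀ C : List ℕ, (∀ v ∈ C, v < M) → ∀ v ∈ A ++ m :: C, v < M := by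
        intro C hC v hv
        simp only [List.mem_append, List.mem_cons] at hv
        rcases hv with hv | rfl | hv
        · exact (hAm v hv).trans hmM
        · exact hmM
        · exact hC v hv
      have hw : A ++ m :: (B ++ (t' ++ [M])) = (A ++ m :: (B ++ t')) ++ [M] := by simp
      rw [hw, treeSum_append_singleton_of_lt α β x (hlt _ ?_), splitSum_append_cons,
        splitSum_append]
      swap
      · intro v hv
        rcases List.mem_append.1 hv with hv | hv
        · exact (hBm v hv).trans hmM
        · exact htM v hv
      -- the splits inside `B`
      have hBsum : ∑ i ∈ Finset.range B.length,
          nodeWeight α β x (A ++ m :: B.take i) (B.drop i ++ t') *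
            treeSum α β x (A ++ m :: B.take i) * treeSum α β x (B.drop i ++ t') =
          x * (treeSum α β x (A ++ [m]) * treeSum α β x (B ++ t')) := by
        rw [Finset.sum_eq_single 0]
        · rw [nodeWeight_ne_nil α β x (by simp) (by simp [hB])]
          simp [mul_assoc]
        · intro i hi hi0
          have : B.take i ≠ [] := by
            simp [hi0, hB]
          rw [treeSum_append_cons_append_eq_zero α β x this
            (fun v hv => hBm v (List.mem_of_mem_take hv))]
          simp
        · intro h
          simp [hB] at h
      -- the splits inside `A`
      have hAsum : ∑ i ∈ Finset.range (A.length + 1),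
          nodeWeight α β x (A.take i) (A.drop i ++ m :: (B ++ t')) *
            treeSum α β x (A.take i) * treeSum α β x (A.drop i ++ m :: (B ++ t')) =
          x * ∑ j ∈ Finset.range t'.length, (∑ i ∈ Finset.range (A.length + 1),
            nodeWeight α β x (A.take i) (A.drop i ++ m :: t'.drop (j + 1)) *
            treeSum α β x (A.take i) * treeSum α β x (A.drop i ++ m :: t'.drop (j + 1))) *
            treeSum α β x (B ++ t'.take j) := by
        simp only [Finset.sum_mul]
        rw [Finset.sum_comm, Finset.mul_sum]
        refine Finset.sum_congr rfl fun i _ => ?_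
        rw [ih t'.length (by omega) t' (A.drop i)
          (fun v hv => hAm v (List.mem_of_mem_drop hv)) ht' hmt' rfl, Finset.mul_sum,
          Finset.mul_sum, Finset.mul_sum]
        refine Finset.sum_congr rfl fun j _ => ?_
        have : nodeWeight α β x (A.take i) (A.drop i ++ m :: (B ++ t')) =
            nodeWeight α β x (A.take i) (A.drop i ++ m :: t'.drop (j + 1)) := by
          simp [nodeWeight]
        rw [this]
        ring
      -- the splits inside the final run
      have htsum : splitSum (fun p q => nodeWeight α β x (A ++ m :: (B ++ p)) q *
            treeSum α β x (A ++ m :: (B ++ p)) * treeSum α β x q) t' =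
          x * ∑ j ∈ Finset.range t'.length, splitSum (fun p q =>
            nodeWeight α β x (A ++ m :: p) q * treeSum α β x (A ++ m :: p) * treeSum α β x q)
              (t'.drop (j + 1)) * treeSum α β x (B ++ t'.take j) := by
        have h1 : ∀ i ∈ Finset.range (t'.length + 1),
            nodeWeight α β x (A ++ m :: (B ++ t'.take i)) (t'.drop i) *
            treeSum α β x (A ++ m :: (B ++ t'.take i)) * treeSum α β x (t'.drop i) =
            ∑ j ∈ Finset.range i, x *
              (nodeWeight α β x (A ++ m :: (t'.take i).drop (j + 1)) (t'.drop i) *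
              treeSum α β x (A ++ m :: (t'.take i).drop (j + 1)) * treeSum α β x (t'.drop i) *
              treeSum α β x (B ++ t'.take j)) := by
          intro i hi
          have hi := Finset.mem_range.1 hi
          have hl : (t'.take i).length = i := by simp; omega
          rw [ih (t'.take i).length (by omega) (t'.take i) A hAm
            (ht'.sublist (List.take_sublist i t'))
            (fun v hv => hmt' v (List.mem_of_mem_take hv)) rfl, hl, Finset.mul_sum,
            Finset.mul_sum, Finset.sum_mul]
          refine Finset.sum_congr rfl fun j hj => ?_
          have hj := Finset.mem_range.1 hj
          have : nodeWeight α β x (A ++ m :: (B ++ t'.take i)) (t'.drop i) =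
              nodeWeight α β x (A ++ m :: (t'.take i).drop (j + 1)) (t'.drop i) := by
            simp [nodeWeight]
          rw [this, List.take_take, min_eq_left hj.le]
          ring
        rw [splitSum, Finset.sum_congr rfl h1, Finset.mul_sum]
        have h2 : ∀ j ∈ Finset.range t'.length, x * (splitSum (fun p q =>
            nodeWeight α β x (A ++ m :: p) q * treeSum α β x (A ++ m :: p) * treeSum α β x q)
              (t'.drop (j + 1)) * treeSum α β x (B ++ t'.take j)) =
            ∑ i ∈ Finset.Ico (j + 1) (t'.length + 1), x *
              (nodeWeight α β x (A ++ m :: (t'.take i).drop (j + 1)) (t'.drop i) *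
              treeSum α β x (A ++ m :: (t'.take i).drop (j + 1)) * treeSum α β x (t'.drop i) *
              treeSum α β x (B ++ t'.take j)) := by
          intro j hj
          have hj := Finset.mem_range.1 hj
          rw [splitSum, Finset.sum_Ico_eq_sum_range, Finset.sum_mul, Finset.mul_sum]
          have : (t'.drop (j + 1)).length + 1 = t'.length + 1 - (j + 1) := by simp; omega
          rw [this]
          refine Finset.sum_congr rfl fun i _ => ?_
          rw [List.drop_drop, List.drop_take, show j + 1 + i - (j + 1) = i by omega]
        rw [Finset.sum_congr rfl h2]
        refine Finset.sum_comm' fun i j => ?_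
        simp only [Finset.mem_range, Finset.mem_Ico]
        omega
      rw [hAsum, hBsum, htsum, Finset.sum_range_succ]
      have hlast : treeSum α β x (A ++ m :: (t' ++ [M]).drop (t'.length + 1)) *
          treeSum α β x (B ++ (t' ++ [M]).take t'.length) =
          treeSum α β x (A ++ [m]) * treeSum α β x (B ++ t') := by
        simp
      have hterm : ∀ j ∈ Finset.range t'.length,
          treeSum α β x (A ++ m :: (t' ++ [M]).drop (j + 1)) *
          treeSum α β x (B ++ (t' ++ [M]).take j) =
          ((∑ i ∈ Finset.range (A.length + 1),
            nodeWeight α β x (A.take i) (A.drop i ++ m :: t'.drop (j + 1)) *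
            treeSum α β x (A.take i) * treeSum α β x (A.drop i ++ m :: t'.drop (j + 1))) +
          splitSum (fun p q =>
            nodeWeight α β x (A ++ m :: p) q * treeSum α β x (A ++ m :: p) * treeSum α β x q)
              (t'.drop (j + 1))) * treeSum α β x (B ++ t'.take j) := by
        intro j hj
        have hj := Finset.mem_range.1 hj
        rw [List.drop_append_of_le_length (by omega), List.take_append_of_le_length (by omega)]
        have : A ++ m :: (t'.drop (j + 1) ++ [M]) = (A ++ m :: t'.drop (j + 1)) ++ [M] := by simp
        rw [this, treeSum_append_singleton_of_lt α β x
          (hlt _ fun v hv => htM v (List.mem_of_mem_drop hv)), splitSum_append_cons]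
      rw [hlast, Finset.sum_congr rfl hterm]
      simp only [add_mul, Finset.sum_add_distrib]
      ring
end

/-! ### Preimages under the stack-sorting map as trees. -/

theorem mem_permWords {n : ℕ} {τ : List ℕ} : τ ∈ permWords n ↔ τ.Perm (List.range' 1 n) := by
  simp [permWords]

theorem nodup_of_mem_permWords {n : ℕ} {τ : List ℕ} (h : τ ∈ permWords n) : τ.Nodup :=
  (mem_permWords.1 h).nodup_iff.2 List.nodup_range'

theorem length_of_mem_permWords {n : ℕ} {τ : List ℕ} (h : τ ∈ permWords n) : τ.length = n := by
  simpa using (mem_permWords.1 h).length_eq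

theorem mem_permWords_iff_bounds {n : ℕ} {τ : List ℕ} :
    τ ∈ permWords n ↔ τ.Nodup ∧ τ.length = n ∧ ∀ v ∈ τ, 1 ≤ v ∧ v ≤ n := by
  constructor
  · refine fun h => ⟨nodup_of_mem_permWords h, length_of_mem_permWords h, fun v hv => ?_⟩
    have := (mem_permWords.1 h).mem_iff.1 hv
    simp at this
    omega
  · rintro ⟨hd, hl, hb⟩
    rw [mem_permWords]
    refine List.Subperm.perm_of_length_le (List.subperm_of_subset hd fun v hv => ?_) (by simp [hl])
    have := hb v hv
    simp
    omega

theorem stackSort_nodup {π : List ℕ} : (stackSort π).Nodup ↔ π.Nodup :=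
  (stackSort_perm π).nodup_iff

/-- The preimages of a word under the stack-sorting map. -/
def stackSortPreimage (τ : List ℕ) : Finset (List ℕ) :=
  τ.permutations.toFinset.filter fun σ => stackSort σ = τ

theorem mem_stackSortPreimage {τ σ : List ℕ} : σ ∈ stackSortPreimage τ ↔ stackSort σ = τ := by
  simp only [stackSortPreimage, Finset.mem_filter, List.mem_toFinset, List.mem_permutations,
    and_iff_right_iff_imp]
  rintro rfl
  exact (stackSort_perm σ).symm

theorem stackSort_eq_append_singleton {σ p : List ℕ} {M : ℕ} (hd : (p ++ [M]).Nodup)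
    (h : stackSort σ = p ++ [M]) : ∃ L R, σ = L ++ M :: R ∧ stackSort L ++ stackSort R = p ∧
      (∀ v ∈ L, v < M) ∧ (∀ v ∈ R, v < M) := by
  have hσ : σ ≠ [] := by rintro rfl; simp at h
  obtain ⟨L, m, R, rfl, hL, hR⟩ := exists_eq_append_max σ hσ (stackSort_nodup.1 (h ▸ hd))
  rw [stackSort_append_max hL hR] at h
  obtain ⟨h1, h2⟩ := List.append_inj' h rfl
  obtain rfl : m = M := by simpa using h2
  exact ⟨L, R, rfl, h1, hL, hR⟩

/-- A preimage `L M R` of `p ++ [M]` amounts to a factorization `p = s(L) s(R)` with a preimage of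
each factor. This is the recursion of `treeSum`; a nonempty `R` contributes one descent, whence the
weights `1, x, x`. -/
theorem sum_stackSortPreimage {R : Type*} [CommSemiring R] (x : R) (τ : List ℕ) (hd : τ.Nodup) :
    ∑ σ ∈ stackSortPreimage τ, x ^ des σ = treeSum 1 x x τ := by
  induction hn : τ.length using Nat.strong_induction_on generalizing τ with
  | _ n ih =>
    rcases List.eq_nil_or_concat τ with rfl | ⟨p, M, rfl⟩
    · have : stackSortPreimage [] = {[]} := by
        ext σ
        rw [mem_stackSortPreimage, Finset.mem_singleton]
        refine ⟨fun h => ?_, fun h => by simp [h]⟩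
        have := stackSort_perm σ
        rw [h] at this
        exact List.nil_perm.1 this
      simp [this, des_nil]
    · rw [List.concat_eq_append] at hn hd ⊢
      rw [List.length_append, List.length_singleton] at hn
      have hpd : p.Nodup := (List.nodup_append.1 hd).1
      rw [treeSum_append_singleton]
      split_ifs with hM
      · have hcond : ∀ i, ∀ L ∈ stackSortPreimage (p.take i), ∀ v ∈ L, v < M := by
          intro i L hL v hv
          have hL := mem_stackSortPreimage.1 hL
          exact hM v (List.mem_of_mem_take (hL ▸ (stackSort_perm L).mem_iff.2 hv))
        have hcond' : ∀ i, ∀ L ∈ stackSortPreimage (p.drop i), ∀ v ∈ L, v < M := by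
          intro i L hL v hv
          have hL := mem_stackSortPreimage.1 hL
          exact hM v (List.mem_of_mem_drop (hL ▸ (stackSort_perm L).mem_iff.2 hv))
        have key : ∀ i ∈ Finset.range (p.length + 1),
            nodeWeight 1 x x (p.take i) (p.drop i) * treeSum 1 x x (p.take i) *
              treeSum 1 x x (p.drop i) =
            ∑ q ∈ stackSortPreimage (p.take i) ×ˢ stackSortPreimage (p.drop i),
              x ^ des (q.1 ++ M :: q.2) := by
          intro i _
          rw [← ih _ (by simp; omega) (p.take i) (hpd.sublist (List.take_sublist _ _)) rfl,
            ← ih _ (by simp; omega) (p.drop i) (hpd.sublist (List.drop_sublist _ _)) rfl,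
            mul_assoc, Finset.sum_mul_sum, ← Finset.sum_product', Finset.mul_sum]
          refine Finset.sum_congr rfl fun q hq => ?_
          obtain ⟨hq1, hq2⟩ := Finset.mem_product.1 hq
          rw [des_append_max _ _ _ (hcond i _ hq1) (hcond' i _ hq2), pow_add, pow_add, mul_comm]
          congr 1
          have : q.2 = [] ↔ p.drop i = [] := by
            have h2 := mem_stackSortPreimage.1 hq2
            have := (stackSort_perm q.2).length_eq
            rw [h2] at this
            rw [← List.length_eq_zero_iff, ← List.length_eq_zero_iff, this]
          unfold nodeWeight
          by_cases h1 : p.take i = [] <;> by_cases h2 : p.drop i = [] <;> simp [h1, h2, this]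
        rw [splitSum, Finset.sum_congr rfl key, Finset.sum_sigma']
        -- The factorization index is recovered as the length of `L`, since `s` preserves length.
        symm
        refine Finset.sum_bij (fun s _ => s.2.1 ++ M :: s.2.2) ?_ ?_ ?_ (fun _ _ => rfl)
        · rintro ⟨i, L, Q⟩ hs
          simp only [Finset.mem_sigma, Finset.mem_product] at hs
          rw [mem_stackSortPreimage, stackSort_append_max (hcond i _ hs.2.1) (hcond' i _ hs.2.2),
            mem_stackSortPreimage.1 hs.2.1, mem_stackSortPreimage.1 hs.2.2,
            List.take_append_drop]
        · rintro ⟨i, L, Q⟩ hs ⟨i', L', Q'⟩ hs' heq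
          simp only [Finset.mem_sigma, Finset.mem_product, Finset.mem_range] at hs hs'
          have hn1 : M ∉ L := fun h => lt_irrefl _ (hcond i _ hs.2.1 M h)
          have hn2 : M ∉ L' := fun h => lt_irrefl _ (hcond i' _ hs'.2.1 M h)
          have hn3 : M ∉ Q := fun h => lt_irrefl _ (hcond' i _ hs.2.2 M h)
          have hn4 : M ∉ Q' := fun h => lt_irrefl _ (hcond' i' _ hs'.2.2 M h)
          dsimp only at heq
          obtain ⟨rfl, rfl⟩ : L = L' ∧ Q = Q' := by
            rw [List.append_eq_append_iff] at heq
            rcases heq with ⟨a, ha, hb⟩ | ⟨a, ha, hb⟩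
            · cases a with
              | nil => simp at ha hb; exact ⟨ha.symm, hb⟩
              | cons c a =>
                simp at hb
                exact absurd (hb.1 ▸ ha ▸ by simp) hn2
            · cases a with
              | nil => simp at ha hb; exact ⟨ha, hb.symm⟩
              | cons c a =>
                simp at hb
                exact absurd (hb.1 ▸ ha ▸ by simp) hn1
          have h1 := (stackSort_perm L).length_eq
          have h2 := h1
          rw [mem_stackSortPreimage.1 hs.2.1, List.length_take] at h1
          rw [mem_stackSortPreimage.1 hs'.2.1, List.length_take] at h2
          obtain rfl : i = i' := by omega
          rfl
        · intro σ hσ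
          obtain ⟨L, Q, rfl, hp, hL, hQ⟩ :=
            stackSort_eq_append_singleton hd (mem_stackSortPreimage.1 hσ)
          refine ⟨⟨(stackSort L).length, L, Q⟩, ?_, rfl⟩
          simp [← hp, mem_stackSortPreimage]
      · rw [Finset.sum_eq_zero]
        intro σ hσ
        obtain ⟨L, Q, rfl, hp, hL, hQ⟩ :=
          stackSort_eq_append_singleton hd (mem_stackSortPreimage.1 hσ)
        refine absurd (fun u hu => ?_) hM
        rw [← hp, List.mem_append, (stackSort_perm L).mem_iff, (stackSort_perm Q).mem_iff] at hu
        exact hu.elim (hL u) (hQ u)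

theorem mem_stackSortable {t n : ℕ} {τ : List ℕ} : τ ∈ stackSortable t n ↔
    τ ∈ permWords n ∧ (stackSort^[t] τ).Pairwise (· < ·) := by
  rw [stackSortable, Finset.mem_filter]

theorem aeval_descentPoly {A : Type*} [CommSemiring A] [Algebra ℝ A] (t n : ℕ) (z : A) :
    Polynomial.aeval z (descentPoly (t + 1) n) = ∑ τ ∈ stackSortable t n, treeSum 1 z z τ := by
  have hmaps : ∀ σ ∈ stackSortable (t + 1) n, stackSort σ ∈ stackSortable t n := by
    intro σ hσ
    simp only [mem_stackSortable, Function.iterate_succ_apply, mem_permWords]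
      at hσ ⊢
    exact ⟨(stackSort_perm σ).trans hσ.1, hσ.2⟩
  rw [descentPoly, map_sum, ← Finset.sum_fiberwise_of_maps_to hmaps]
  refine Finset.sum_congr rfl fun τ hτ => ?_
  simp only [mem_stackSortable] at hτ
  rw [← sum_stackSortPreimage z τ (nodup_of_mem_permWords hτ.1)]
  refine Finset.sum_congr ?_ fun σ _ => by simp
  ext σ
  rw [Finset.mem_filter]
  simp only [mem_stackSortable, Function.iterate_succ_apply, mem_permWords,
    mem_stackSortPreimage] at hτ ⊢
  constructor
  · exact fun h => h.2
  · rintro rfl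
    exact ⟨⟨(stackSort_perm σ).symm.trans hτ.1, hτ.2⟩, rfl⟩

/-! ### Avoidance of 231 and two-stack-sortability. -/

/-- A word avoids the pattern `231`. -/
def Avoids231 : List ℕ → Prop
  | [] => True
  | u :: l => Avoids231 l ∧ l.Pairwise fun v w => ¬(w < u ∧ u < v)

theorem avoids231_append (l₁ l₂ : List ℕ) : Avoids231 (l₁ ++ l₂) ↔
    Avoids231 l₁ ∧ Avoids231 l₂ ∧ (∀ u ∈ l₁, l₂.Pairwise fun v w => ¬(w < u ∧ u < v)) ∧
      l₁.Pairwise fun u v => ∀ w ∈ l₂, ¬(w < u ∧ u < v) := by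
  induction l₁ with
  | nil => simp [Avoids231]
  | cons a l₁ ih =>
    simp only [List.cons_append, Avoids231, ih, List.pairwise_append, List.mem_cons,
      forall_eq_or_imp, List.pairwise_cons]
    tauto

theorem avoids231_map (g : ℕ → ℕ) (l : List ℕ) (h : ∀ a ∈ l, ∀ b ∈ l, (g a < g b ↔ a < b)) :
    Avoids231 (l.map g) ↔ Avoids231 l := by
  induction l with
  | nil => simp
  | cons a l ih =>
    simp only [List.map_cons, Avoids231]
    rw [ih (fun u hu v hv => h u (by simp [hu]) v (by simp [hv])), List.pairwise_map]
    refine and_congr_right fun _ => List.Pairwise.iff_of_mem fun hu hv => ?_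
    rw [h _ (by simp [hv]) _ (by simp), h _ (by simp) _ (by simp [hu])]

theorem pairwise_of_forall_mem {α : Type*} {r : α → α → Prop} {l : List α}
    (h : ∀ u ∈ l, ∀ v ∈ l, r u v) : l.Pairwise r :=
  List.pairwise_iff_forall_sublist.2 fun {u v} hs =>
    h u (hs.subset (by simp)) v (hs.subset (by simp))

/-- Knuth's criterion. The word `s(L) s(R) m` is increasing when both factors are and no letter of
`L` exceeds one of `R`; a letter of `L` exceeding one of `R` forms a 231 with the maximum `m`
between them. -/
theorem stackSort_sorted_iff (π : List ℕ) (hd : π.Nodup) :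
    (stackSort π).Pairwise (· < ·) ↔ Avoids231 π := by
  refine append_max_induction (P := fun π => (stackSort π).Pairwise (· < ·) ↔ Avoids231 π)
    (by simp [Avoids231]) (fun L m R hd hL hR ihL ihR => ?_) π hd
  rw [stackSort_append_max hL hR, avoids231_append, Avoids231, ← ihL, ← ihR]
  have hne : ∀ u ∈ L, ∀ w ∈ R, u ≠ w := by
    intro u hu w hw
    have := (List.nodup_append.1 hd).2.2 u hu w (by simp [hw])
    exact this
  simp only [List.append_assoc, List.pairwise_append, List.mem_append,
    (stackSort_perm _).mem_iff, List.pairwise_cons, List.mem_cons, forall_eq_or_imp]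
  constructor
  · rintro ⟨h1, ⟨h2, -, h3⟩, h4⟩
    refine ⟨h1, ⟨h2, ?_⟩, fun u hu => ⟨fun w hw hh => ?_, ?_⟩, ?_⟩
    · exact pairwise_of_forall_mem fun v hv w hw hh => by
        have := hR v hv; omega
    · have := h4 u hu w (Or.inl hw)
      omega
    · exact pairwise_of_forall_mem fun v hv w hw hh => by
        have := h4 u hu w (Or.inl hw); omega
    · refine pairwise_of_forall_mem fun u hu v hv => ⟨fun hh => ?_, fun w hw hh => ?_⟩
      · have := hL u hu; omega
      · have := h4 u hu w (Or.inl hw); omega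
  · rintro ⟨h1, ⟨h2, -⟩, h3, -⟩
    refine ⟨h1, ⟨h2, by simp, fun u hu => ⟨hR u hu, by simp⟩⟩, fun u hu v hv => ?_⟩
    rcases hv with hv | hv
    · have h5 := (h3 u hu).1 v hv
      have := hL u hu
      have := hne u hu v hv
      omega
    · simp at hv; exact hv ▸ hL u hu

theorem stackSort_stackSort_sorted_iff (π : List ℕ) (hd : π.Nodup) :
    (stackSort (stackSort π)).Pairwise (· < ·) ↔ Avoids231 (stackSort π) :=
  stackSort_sorted_iff _ (stackSort_nodup.2 hd)

theorem avoids231_append_max {l : List ℕ} {m : ℕ} (h : ∀ v ∈ l, v < m) :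
    Avoids231 (l ++ [m]) ↔ Avoids231 l := by
  rw [avoids231_append]
  simp only [Avoids231, List.Pairwise.nil, and_self, List.pairwise_singleton, implies_true,
    true_and, List.mem_singleton, forall_eq, and_iff_left_iff_imp]
  exact fun _ => pairwise_of_forall_mem fun u hu v hv hh => by
    have := h u hu; omega

theorem avoids231_stackSort_append_max {L R : List ℕ} {m : ℕ} (hL : ∀ v ∈ L, v < m)
    (hR : ∀ v ∈ R, v < m) :
    Avoids231 (stackSort (L ++ m :: R)) ↔ Avoids231 (stackSort L ++ stackSort R) := by
  rw [stackSort_append_max hL hR, avoids231_append_max]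
  intro v hv
  rw [List.mem_append, (stackSort_perm L).mem_iff, (stackSort_perm R).mem_iff] at hv
  exact hv.elim (hL v) (hR v)

/-- For `u ∈ C` and a later `w < u`, the letters `u, M, w` form a 231. So only `M` may exceed
letters of `S`, and then those below `M` must precede those above it. -/
theorem avoids231_append_of_max {C S : List ℕ} {M : ℕ} (hC : ∀ v ∈ C, v < M)
    (hne : ∀ u ∈ C, ∀ w ∈ S, u ≠ w) :
    Avoids231 ((C ++ [M]) ++ S) ↔ Avoids231 (C ++ [M]) ∧ Avoids231 S ∧
      (∀ u ∈ C, ∀ w ∈ S, u < w) ∧ S.Pairwise fun v w => ¬(w < M ∧ M < v) := by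
  rw [avoids231_append]
  refine and_congr_right fun _ => and_congr_right fun _ => ?_
  simp only [List.pairwise_append, List.mem_append, List.mem_singleton, List.pairwise_singleton]
  constructor
  · rintro ⟨h1, h2, -, h3⟩
    refine ⟨fun u hu w hw => ?_, h1 M (Or.inr rfl)⟩
    have := h3 u hu M rfl w hw
    have := hC u hu
    have := hne u hu w hw
    omega
  · rintro ⟨h1, h2⟩
    refine ⟨fun u hu => ?_, ?_, trivial, fun u hu v hv w hw hh => ?_⟩
    · rcases hu with hu | rfl
      · exact pairwise_of_forall_mem fun v hv w hw hh => by
          have := h1 u hu w hw; omega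
      · exact h2
    · exact pairwise_of_forall_mem fun u hu v hv w hw hh => by
        have := h1 u hu w hw; omega
    · have := h1 u hu w hw; omega

theorem stackSort_eq_append_max {π : List ℕ} (hd : π.Nodup) (h : π ≠ []) :
    ∃ C M, stackSort π = C ++ [M] ∧ ∀ v ∈ C, v < M := by
  obtain ⟨L, m, R, rfl, hL, hR⟩ := exists_eq_append_max π h hd
  refine ⟨_, m, stackSort_append_max hL hR, fun v hv => ?_⟩
  rw [List.mem_append, (stackSort_perm L).mem_iff, (stackSort_perm R).mem_iff] at hv
  exact hv.elim (hL v) (hR v)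

theorem mem_of_mem_permWords {n v : ℕ} {τ : List ℕ} (h : τ ∈ permWords n) :
    v ∈ τ ↔ 1 ≤ v ∧ v ≤ n := by
  rw [(mem_permWords.1 h).mem_iff]
  simp
  omega

theorem stackSort_eq_append_length {A : List ℕ} {a : ℕ} (hA : A ∈ permWords a) (h : A ≠ []) :
    ∃ C, stackSort A = C ++ [a] ∧ (∀ v ∈ C, v < a) ∧ 1 ≤ a ∧ ∀ v ∈ C, 1 ≤ v := by
  obtain ⟨C, M, hC, hlt⟩ := stackSort_eq_append_max (nodup_of_mem_permWords hA) h
  have hmem : ∀ v, v ∈ C ∨ v = M ↔ 1 ≤ v ∧ v ≤ a := by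
    intro v
    rw [← mem_of_mem_permWords hA, ← (stackSort_perm A).mem_iff, hC]
    simp
  have h1 := (hmem M).1 (Or.inr rfl)
  have : M = a := by
    rcases (hmem a).2 ⟨by omega, le_rfl⟩ with h | h
    · have := hlt a h; omega
    · exact h.symm
  subst this
  exact ⟨C, hC, hlt, h1.1, fun v hv => ((hmem v).1 (Or.inl hv)).1⟩

theorem mem_stackSortable_two {n : ℕ} {τ : List ℕ} :
    τ ∈ stackSortable 2 n ↔ τ ∈ permWords n ∧ Avoids231 (stackSort τ) := by
  rw [mem_stackSortable]
  exact and_congr_right fun h => stackSort_stackSort_sorted_iff τ (nodup_of_mem_permWords h)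

/-! ### Decomposition of two-stack-sortable words at their maximum. -/

/-- The positions `k` such that in `s(τ)` no entry greater than `k` precedes one that is at
most `k`. -/
def cuts (τ : List ℕ) : Finset ℕ :=
  (Finset.range (τ.length + 1)).filter fun k =>
    (stackSort τ).Pairwise fun v w => ¬(w ≤ k ∧ k < v)

theorem mem_cuts {τ : List ℕ} {k : ℕ} : k ∈ cuts τ ↔
    k ≤ τ.length ∧ (stackSort τ).Pairwise fun v w => ¬(w ≤ k ∧ k < v) := by
  rw [cuts, Finset.mem_filter, Finset.mem_range, Nat.lt_succ_iff]

/-- The admissible interleavings of the values of a left word `A` and a right word `B`. -/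
def interleavings (A B : List ℕ) : Finset ℕ := if A = [] then {0} else cuts B

/-- The left word keeps the values `1, …, a - 1`, and its maximum is raised above `k` letters of the
right word. -/
def relabelLeft (a k v : ℕ) : ℕ := if v = a then a + k else v

/-- The right word takes the values from `a` on, omitting `a + k`. For `a = 0` the interleaving is
`k = 0` and letters are at least 1, so the truncated subtraction is never reached. -/
def relabelRight (a k v : ℕ) : ℕ := if v ≤ k then v + a - 1 else v + a

/-- The word with maximum at position `A.length`, left part of the order type of `A`, right part
of the order type of `B`, in which exactly `k` entries of the right part lie below the maximum of
the left part, and all of them above the other entries of the left part. -/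
def glue (A B : List ℕ) (k : ℕ) : List ℕ :=
  A.map (relabelLeft A.length k) ++ (A.length + B.length + 1) ::
    B.map (relabelRight A.length k)

theorem relabelLeft_lt_iff {a k u v : ℕ} (hu : u ≤ a) (hv : v ≤ a) :
    relabelLeft a k u < relabelLeft a k v ↔ u < v := by
  unfold relabelLeft; split_ifs <;> omega

theorem relabelRight_lt_iff {a k u v : ℕ} (hu : 1 ≤ u) (hv : 1 ≤ v) :
    relabelRight a k u < relabelRight a k v ↔ u < v := by
  unfold relabelRight; split_ifs <;> omega

section
variable {a b k : ℕ} {A B : List ℕ}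

theorem mem_interleavings (hk : k ∈ interleavings A B) :
    k ≤ B.length ∧ (A = [] → k = 0) ∧ (A ≠ [] → k ∈ cuts B) := by
  unfold interleavings at hk
  split_ifs at hk with h
  · have : k = 0 := by simpa using hk
    simp [h, this]
  · exact ⟨(mem_cuts.1 hk).1, fun h' => absurd h' h, fun _ => hk⟩

theorem relabelLeft_lt (hA : A ∈ permWords a)
    (hk : k ∈ interleavings A B) :
    ∀ v ∈ A.map (relabelLeft A.length k), v < A.length + B.length + 1 := by
  intro v hv
  obtain ⟨u, hu, rfl⟩ := List.mem_map.1 hv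
  have h1 := (mem_of_mem_permWords hA).1 hu
  have h2 := (mem_interleavings hk).1
  rw [length_of_mem_permWords hA]
  unfold relabelLeft
  split_ifs <;> omega

theorem relabelRight_lt (hB : B ∈ permWords b) :
    ∀ v ∈ B.map (relabelRight A.length k), v < A.length + B.length + 1 := by
  intro v hv
  obtain ⟨u, hu, rfl⟩ := List.mem_map.1 hv
  have h1 := (mem_of_mem_permWords hB).1 hu
  rw [length_of_mem_permWords hB]
  unfold relabelRight
  split_ifs <;> omega

theorem stackSort_map_relabelLeft (hA : A ∈ permWords a) :
    stackSort (A.map (relabelLeft a k)) = (stackSort A).map (relabelLeft a k) :=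
  stackSort_map _ _ fun _ hu _ hv => relabelLeft_lt_iff ((mem_of_mem_permWords hA).1 hu).2
    ((mem_of_mem_permWords hA).1 hv).2

theorem stackSort_map_relabelRight (hB : B ∈ permWords b) :
    stackSort (B.map (relabelRight a k)) = (stackSort B).map (relabelRight a k) :=
  stackSort_map _ _ fun _ hu _ hv => relabelRight_lt_iff ((mem_of_mem_permWords hB).1 hu).1
    ((mem_of_mem_permWords hB).1 hv).1

theorem length_glue : (glue A B k).length = A.length + B.length + 1 := by
  simp [glue]; omega

theorem glue_mem_permWords (hA : A ∈ permWords a) (hB : B ∈ permWords b)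
    (hk : k ∈ interleavings A B) : glue A B k ∈ permWords (a + b + 1) := by
  have hla := length_of_mem_permWords hA
  have hlb := length_of_mem_permWords hB
  have hk1 := mem_interleavings hk
  have hA' := @mem_of_mem_permWords a
  rw [mem_permWords_iff_bounds, length_glue, hla, hlb]
  refine ⟨?_, rfl, fun v hv => ?_⟩
  · rw [glue, List.nodup_append, List.nodup_cons]
    refine ⟨?_, ⟨fun h => lt_irrefl _ (relabelRight_lt (A := A) (k := k) hB _ h), ?_⟩, ?_⟩
    · refine (List.nodup_map_iff_inj_on (nodup_of_mem_permWords hA)).2 fun u hu v hv h => ?_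
      have h1 := relabelLeft_lt_iff (k := k) (hA' hA |>.1 hu).2 (hA' hA |>.1 hv).2
      have h2 := relabelLeft_lt_iff (k := k) (hA' hA |>.1 hv).2 (hA' hA |>.1 hu).2
      rw [hla] at h
      omega
    · refine (List.nodup_map_iff_inj_on (nodup_of_mem_permWords hB)).2 fun u hu v hv h => ?_
      have h3 := (mem_of_mem_permWords hB).1 hu
      have h4 := (mem_of_mem_permWords hB).1 hv
      have h1 := relabelRight_lt_iff (a := A.length) (k := k) h3.1 h4.1
      have h2 := relabelRight_lt_iff (a := A.length) (k := k) h4.1 h3.1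
      omega
    · intro u hu v hv
      rcases List.mem_cons.1 hv with rfl | hv
      · exact (relabelLeft_lt hA hk u hu).ne
      · obtain ⟨u', hu', rfl⟩ := List.mem_map.1 hu
        obtain ⟨v', hv', rfl⟩ := List.mem_map.1 hv
        have h1 := (mem_of_mem_permWords hA).1 hu'
        have h2 := (mem_of_mem_permWords hB).1 hv'
        rw [hla]
        unfold relabelLeft relabelRight
        split_ifs <;> omega
  · simp only [glue, List.mem_append, List.mem_cons, List.mem_map, hla, hlb] at hv
    rcases hv with ⟨u, hu, rfl⟩ | rfl | ⟨u, hu, rfl⟩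
    · have h1 := (mem_of_mem_permWords hA).1 hu
      unfold relabelLeft
      split_ifs <;> omega
    · omega
    · have h1 := (mem_of_mem_permWords hB).1 hu
      have : A = [] → k = 0 := hk1.2.1
      have : a = 0 → k = 0 := fun h => this (List.length_eq_zero_iff.1 (by omega))
      unfold relabelRight
      split_ifs <;> omega

theorem stackSort_glue (hA : A ∈ permWords a) (hB : B ∈ permWords b)
    (hk : k ∈ interleavings A B) : stackSort (glue A B k) =
      (stackSort A).map (relabelLeft a k) ++ (stackSort B).map (relabelRight a k) ++
        [a + b + 1] := by
  rw [glue, stackSort_append_max (relabelLeft_lt hA hk) (relabelRight_lt hB),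
    length_of_mem_permWords hA, length_of_mem_permWords hB, stackSort_map_relabelLeft hA,
    stackSort_map_relabelRight hB]

theorem avoids231_map_relabelRight (hB : B ∈ permWords b) :
    Avoids231 ((stackSort B).map (relabelRight a k)) ↔ Avoids231 (stackSort B) := by
  refine avoids231_map _ _ fun u hu v hv => ?_
  rw [(stackSort_perm B).mem_iff] at hu hv
  exact relabelRight_lt_iff ((mem_of_mem_permWords hB).1 hu).1 ((mem_of_mem_permWords hB).1 hv).1

theorem avoids231_map_relabelLeft (hA : A ∈ permWords a) :
    Avoids231 ((stackSort A).map (relabelLeft a k)) ↔ Avoids231 (stackSort A) := by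
  refine avoids231_map _ _ fun u hu v hv => ?_
  rw [(stackSort_perm A).mem_iff] at hu hv
  exact relabelLeft_lt_iff ((mem_of_mem_permWords hA).1 hu).2 ((mem_of_mem_permWords hA).1 hv).2

theorem glue_mem (hA : A ∈ stackSortable 2 a) (hB : B ∈ stackSortable 2 b)
    (hk : k ∈ interleavings A B) : glue A B k ∈ stackSortable 2 (a + b + 1) := by
  rw [mem_stackSortable_two] at hA hB ⊢
  have hg := glue_mem_permWords hA.1 hB.1 hk
  refine ⟨hg, ?_⟩
  rw [stackSort_glue hA.1 hB.1 hk, avoids231_append_max]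
  swap
  · have hnd := stackSort_nodup.2 (nodup_of_mem_permWords hg)
    intro v hv
    rw [List.mem_append, ← stackSort_map_relabelLeft hA.1, ← stackSort_map_relabelRight hB.1,
      (stackSort_perm _).mem_iff, (stackSort_perm _).mem_iff] at hv
    have h1 := relabelLeft_lt hA.1 hk v
    have h2 := relabelRight_lt (A := A) (k := k) hB.1 v
    rw [length_of_mem_permWords hA.1, length_of_mem_permWords hB.1] at h1 h2
    exact hv.elim h1 h2
  by_cases hAe : A = []
  · subst hAe
    simpa using (avoids231_map_relabelRight hB.1).2 hB.2
  · obtain ⟨C, hC, hCa, ha, hC1⟩ := stackSort_eq_append_length hA.1 hAe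
    have hL : (stackSort A).map (relabelLeft a k) = C.map (relabelLeft a k) ++ [a + k] := by
      rw [hC]; simp [relabelLeft]
    have hL2 : C.map (relabelLeft a k) = C := by
      refine List.map_congr_left (g := id) (fun v hv => ?_) |>.trans (by simp)
      have := hCa v hv
      simp [relabelLeft, this.ne]
    have h3 := (avoids231_map_relabelLeft (k := k) hA.1).2 hA.2
    rw [hL, hL2] at h3 ⊢
    have hSlt : ∀ u ∈ C, ∀ w ∈ (stackSort B).map (relabelRight a k), u < w := by
      intro u hu w hw
      obtain ⟨w', hw', rfl⟩ := List.mem_map.1 hw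
      rw [(stackSort_perm B).mem_iff] at hw'
      have h1 := (mem_of_mem_permWords hB.1).1 hw'
      have := hCa u hu
      unfold relabelRight
      split_ifs <;> omega
    rw [avoids231_append_of_max (fun v hv => by have := hCa v hv; omega)
      (fun u hu w hw => (hSlt u hu w hw).ne)]
    refine ⟨h3, (avoids231_map_relabelRight hB.1).2 hB.2, hSlt, ?_⟩
    rw [List.pairwise_map]
    refine (mem_cuts.1 ((mem_interleavings hk).2.2 hAe)).2.imp fun {v w} h => ?_
    unfold relabelRight
    split_ifs <;> omega

end

theorem eq_of_map_eq_map {α β : Type*} {f : α → β} {l l' : List α}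
    (h : ∀ u ∈ l, ∀ v ∈ l', f u = f v → u = v) (hl : l.map f = l'.map f) : l = l' := by
  induction l generalizing l' with
  | nil => simpa [eq_comm] using hl
  | cons u l ih =>
    cases l' with
    | nil => simp at hl
    | cons v l' =>
      simp only [List.map_cons, List.cons.injEq] at hl ⊢
      exact ⟨h u (by simp) v (by simp) hl.1,
        ih (fun u hu v hv => h u (by simp [hu]) v (by simp [hv])) hl.2⟩

section
variable {a b k : ℕ} {A B : List ℕ}

theorem glue_injective {a' b' k' : ℕ} {A' B' : List ℕ} (hA : A ∈ permWords a)
    (hB : B ∈ permWords b) (hk : k ∈ interleavings A B) (hA' : A' ∈ permWords a')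
    (hB' : B' ∈ permWords b') (hk' : k' ∈ interleavings A' B')
    (h : glue A B k = glue A' B' k') : A = A' ∧ B = B' ∧ k = k' := by
  have hlen := congrArg List.length h
  rw [length_glue, length_glue] at hlen
  have hla := length_of_mem_permWords hA
  have hla' := length_of_mem_permWords hA'
  have hsplit : A.map (relabelLeft A.length k) = A'.map (relabelLeft A'.length k') ∧
      B.map (relabelRight A.length k) = B'.map (relabelRight A'.length k') := by
    have hn1 : A.length + B.length + 1 ∉ A.map (relabelLeft A.length k) :=
      fun h => lt_irrefl _ (relabelLeft_lt hA hk _ h)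
    have hn2 : A.length + B.length + 1 ∉ A'.map (relabelLeft A'.length k') :=
      fun h => by have := relabelLeft_lt hA' hk' _ h; omega
    unfold glue at h
    rw [← hlen] at h
    rw [List.append_eq_append_iff] at h
    rcases h with ⟨c, hc, hd⟩ | ⟨c, hc, hd⟩
    · cases c with
      | nil => simp at hc hd; exact ⟨hc.symm, hd⟩
      | cons v c =>
        simp only [List.cons_append, List.cons.injEq] at hd
        exact absurd (hd.1 ▸ hc ▸ by simp) hn2
    · cases c with
      | nil => simp at hc hd; exact ⟨hc, hd.symm⟩
      | cons v c =>
        simp only [List.cons_append, List.cons.injEq] at hd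
        exact absurd (hd.1 ▸ hc ▸ by simp) hn1
  obtain ⟨h1, h2⟩ := hsplit
  have haa : A.length = A'.length := by simpa using congrArg List.length h1
  obtain rfl : a = a' := by omega
  rw [haa, hla'] at h1 h2
  -- The left maximum is `a + k`, so `k` can be read off; the two memberships give both
  -- inequalities.
  have hkk : k = k' := by
    by_cases hAe : A = []
    · have hAe' : A' = [] := List.length_eq_zero_iff.1 (by rw [← haa, hAe]; rfl)
      rw [(mem_interleavings hk).2.1 hAe, (mem_interleavings hk').2.1 hAe']
    · have hpos : 1 ≤ a := by
        have := List.length_pos_of_ne_nil hAe; omega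
      have hm1 : a + k ∈ A'.map (relabelLeft a k') := by
        rw [← h1, List.mem_map]
        exact ⟨a, (mem_of_mem_permWords hA).2 ⟨hpos, le_rfl⟩, by simp [relabelLeft]⟩
      have hm2 : a + k' ∈ A.map (relabelLeft a k) := by
        rw [h1, List.mem_map]
        exact ⟨a, (mem_of_mem_permWords hA').2 ⟨hpos, le_rfl⟩, by simp [relabelLeft]⟩
      obtain ⟨u, hu, hu1⟩ := List.mem_map.1 hm1
      obtain ⟨v, hv, hv1⟩ := List.mem_map.1 hm2
      have := (mem_of_mem_permWords hA').1 hu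
      have := (mem_of_mem_permWords hA).1 hv
      unfold relabelLeft at hu1 hv1
      split_ifs at hu1 hv1 <;> omega
  subst hkk
  refine ⟨?_, ?_, rfl⟩
  · refine eq_of_map_eq_map (fun u hu v hv huv => ?_) h1
    have h3 := ((mem_of_mem_permWords hA).1 hu).2
    have h4 := ((mem_of_mem_permWords hA').1 hv).2
    have := relabelLeft_lt_iff (k := k) h3 h4
    have := relabelLeft_lt_iff (k := k) h4 h3
    omega
  · refine eq_of_map_eq_map (fun u hu v hv huv => ?_) h2
    have h3 := ((mem_of_mem_permWords hB).1 hu).1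
    have h4 := ((mem_of_mem_permWords hB').1 hv).1
    have := relabelRight_lt_iff (a := a) (k := k) h3 h4
    have := relabelRight_lt_iff (a := a) (k := k) h4 h3
    omega

end

theorem mem_permWords_of_map {L : List ℕ} {c : ℕ} (g : ℕ → ℕ) (hd : L.Nodup) (hl : L.length = c)
    (hb : ∀ v ∈ L, 1 ≤ g v ∧ g v ≤ c) (hg : ∀ u ∈ L, ∀ v ∈ L, (g u < g v ↔ u < v)) :
    L.map g ∈ permWords c := by
  rw [mem_permWords_iff_bounds, List.length_map]
  refine ⟨(List.nodup_map_iff_inj_on hd).2 fun u hu v hv h => ?_, hl, fun v hv => ?_⟩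
  · have := hg u hu v hv
    have := hg v hv u hu
    omega
  · obtain ⟨u, hu, rfl⟩ := List.mem_map.1 hv
    exact hb u hu

theorem length_lt_of_nodup {C : List ℕ} {w : ℕ} (hd : C.Nodup) (h1 : ∀ v ∈ C, 1 ≤ v ∧ v < w)
    (hw : 1 ≤ w) : C.length < w := by
  have : C ⊆ List.range' 1 (w - 1) := fun v hv => by
    have := h1 v hv
    simp
    omega
  have := (List.subperm_of_subset hd this).length_le
  simp only [List.length_range'] at this
  omega

/-- Write `τ = L m R` and `s(L) = C M`. By `avoids231_append_of_max` the letters of `C` lie below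
`R`, so they fill `1, …, a - 1`; the only freedom left is the rank of `M` among the letters of `R`,
which must be a cut. -/
theorem exists_glue_eq {n : ℕ} {τ : List ℕ} (hτ : τ ∈ stackSortable 2 (n + 1)) :
    ∃ a b A B k, a + b = n ∧ A ∈ stackSortable 2 a ∧ B ∈ stackSortable 2 b ∧
      k ∈ interleavings A B ∧ glue A B k = τ := by
  rw [mem_stackSortable_two] at hτ
  obtain ⟨hp, hav⟩ := hτ
  have hnd := nodup_of_mem_permWords hp
  have hlen := length_of_mem_permWords hp
  obtain ⟨A', m, B', rfl, hA, hB⟩ := exists_eq_append_max τ (by rintro rfl; simp at hlen) hnd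
  rw [avoids231_stackSort_append_max hA hB] at hav
  have hmem : ∀ v, (v ∈ A' ∨ v = m ∨ v ∈ B') ↔ 1 ≤ v ∧ v ≤ n + 1 := fun v => by
    rw [← mem_of_mem_permWords hp]; simp
  have hm : m = n + 1 := by
    have h1 := (hmem m).1 (by simp)
    rcases (hmem (n + 1)).2 ⟨by omega, le_rfl⟩ with h | h | h
    · have := hA _ h; omega
    · exact h.symm
    · have := hB _ h; omega
  subst hm
  have hlen' : A'.length + B'.length = n := by simp at hlen; omega
  have hndA : A'.Nodup := (List.nodup_append.1 hnd).1
  have hndB : B'.Nodup := (List.nodup_cons.1 (List.nodup_append.1 hnd).2.1).2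
  have hne : ∀ u ∈ A', ∀ w ∈ B', u ≠ w := fun u hu w hw =>
    (List.nodup_append.1 hnd).2.2 u hu w (by simp [hw])
  by_cases hAe : A' = []
  · subst hAe
    have hB' : B' ∈ permWords n := by
      rw [mem_permWords_iff_bounds]
      refine ⟨hndB, by simpa using hlen', fun v hv => ?_⟩
      have := (hmem v).1 (by simp [hv])
      have := hB v hv
      omega
    refine ⟨0, n, [], B', 0, by simp, ?_, ?_, by simp [interleavings], ?_⟩
    · rw [mem_stackSortable_two]
      simp [mem_permWords, Avoids231]
    · rw [mem_stackSortable_two]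
      exact ⟨hB', by simpa using hav⟩
    · have : B'.map (relabelRight 0 0) = B' := by
        refine List.map_congr_left (g := id) (fun v hv => ?_) |>.trans (by simp)
        have := (mem_of_mem_permWords hB').1 hv
        simp [relabelRight]
        omega
      have hl : B'.length = n := by simpa using hlen'
      simp [glue, this, hl]
  · obtain ⟨C, M, hC, hCM⟩ := stackSort_eq_append_max hndA hAe
    have hmemA : ∀ v, v ∈ A' ↔ v ∈ C ∨ v = M := fun v => by
      rw [← (stackSort_perm A').mem_iff, hC]; simp
    have hmemB : ∀ v, v ∈ stackSort B' ↔ v ∈ B' := fun v => (stackSort_perm B').mem_iff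
    have hlC : C.length + 1 = A'.length := by
      have := (stackSort_perm A').length_eq
      rw [hC] at this
      simpa using this
    have hndC : C.Nodup := by
      have := stackSort_nodup.2 hndA
      rw [hC] at this
      exact (List.nodup_append.1 this).1
    rw [hC, avoids231_append_of_max hCM
      (fun u hu w hw => hne u ((hmemA u).2 (Or.inl hu)) w ((hmemB w).1 hw))] at hav
    obtain ⟨hav1, hav2, hCB, hcut⟩ := hav
    replace hCB : ∀ u ∈ C, ∀ w ∈ B', u < w := fun u hu w hw => hCB u hu w ((hmemB w).2 hw)
    set a := A'.length with ha
    have hMA : M ∈ A' := (hmemA M).2 (Or.inr rfl)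
    have hMb := (hmem M).1 (Or.inl hMA)
    have hMn := hA M hMA
    have hCb : ∀ v ∈ C, 1 ≤ v ∧ v < a := by
      intro v hv
      have hvA := (hmemA v).2 (Or.inl hv)
      have hv1 := (hmem v).1 (Or.inl hvA)
      refine ⟨hv1.1, ?_⟩
      -- Every value up to `v` lies in `C`, because `M`, the maximum of `τ` and the letters of `B'`
      -- all exceed `v`. Thus `v` is at most the length of `C`.
      have hsub : List.range' 1 v ⊆ C := by
        intro w hw
        have hw : 1 ≤ w ∧ w < 1 + v := by simpa using hw
        rcases (hmem w).2 ⟨hw.1, by omega⟩ with h | h | h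
        · rcases (hmemA w).1 h with h | h
          · exact h
          · have := hCM v hv; omega
        · have := hA v hvA; omega
        · have := hCB v hv w h; omega
      have := (List.subperm_of_subset List.nodup_range' hsub).length_le
      simp only [List.length_range'] at this
      omega
    have haM : a ≤ M := by
      have := length_lt_of_nodup (w := M) hndC (fun v hv => ⟨(hCb v hv).1, hCM v hv⟩) (by omega)
      omega
    have hBb : ∀ w ∈ B', a ≤ w ∧ w ≤ n ∧ w ≠ M := by
      intro w hw
      have h1 := (hmem w).1 (by simp [hw])
      have h2 := length_lt_of_nodup (w := w) hndC (fun v hv => ⟨(hCb v hv).1, hCB v hv w hw⟩)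
        (by omega)
      have h3 := hB w hw
      exact ⟨by omega, by omega, fun h => hne M hMA w hw h.symm⟩
    -- On the letters concerned, `f` and `g` invert `relabelLeft` and `relabelRight` for `k = M -
    -- a`.
    let f : ℕ → ℕ := fun v => if v = M then a else v
    let g : ℕ → ℕ := fun v => if v < M then v - (a - 1) else v - a
    have hAb : ∀ v ∈ A', (1 ≤ v ∧ v < a) ∨ v = M := fun v hv =>
      ((hmemA v).1 hv).imp_left (hCb v)
    have hf : ∀ u ∈ A', ∀ v ∈ A', (f u < f v ↔ u < v) := by
      intro u hu v hv
      have := hAb u hu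
      have := hAb v hv
      simp only [f]
      split_ifs <;> omega
    have hg : ∀ u ∈ B', ∀ v ∈ B', (g u < g v ↔ u < v) := by
      intro u hu v hv
      have := hBb u hu
      have := hBb v hv
      simp only [g]
      split_ifs <;> omega
    have hfA : A'.map f ∈ permWords a := by
      refine mem_permWords_of_map f hndA rfl (fun v hv => ?_) hf
      have := hAb v hv
      simp only [f]
      split_ifs <;> omega
    have hgB : B'.map g ∈ permWords B'.length := by
      refine mem_permWords_of_map g hndB rfl (fun v hv => ?_) hg
      have := hBb v hv
      simp only [g]
      split_ifs <;> omega
    refine ⟨a, B'.length, A'.map f, B'.map g, M - a, hlen', ?_, ?_, ?_, ?_⟩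
    · rw [mem_stackSortable_two]
      refine ⟨hfA, ?_⟩
      rw [stackSort_map f A' hf, avoids231_map, hC]
      · exact hav1
      · intro u hu v hv
        rw [(stackSort_perm A').mem_iff] at hu hv
        exact hf u hu v hv
    · rw [mem_stackSortable_two]
      refine ⟨hgB, ?_⟩
      rw [stackSort_map g B' hg, avoids231_map]
      · exact hav2
      · intro u hu v hv
        rw [hmemB] at hu hv
        exact hg u hu v hv
    · rw [interleavings, if_neg (by simpa using hAe), mem_cuts, List.length_map,
        stackSort_map g B' hg, List.pairwise_map]
      refine ⟨by omega, ?_⟩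
      refine hcut.imp_of_mem fun {v w} hv hw h => ?_
      have := hBb v ((hmemB v).1 hv)
      have := hBb w ((hmemB w).1 hw)
      simp only [g]
      split_ifs <;> omega
    · have h1 : (A'.map f).map (relabelLeft a (M - a)) = A' := by
        rw [List.map_map]
        refine List.map_congr_left (g := id) (fun v hv => ?_) |>.trans (by simp)
        have := hAb v hv
        simp only [f, Function.comp, relabelLeft, id]
        split_ifs <;> omega
      have h2 : (B'.map g).map (relabelRight a (M - a)) = B' := by
        rw [List.map_map]
        refine List.map_congr_left (g := id) (fun v hv => ?_) |>.trans (by simp)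
        have := hBb v hv
        simp only [g, Function.comp, relabelRight, id]
        split_ifs <;> omega
      rw [glue, List.length_map, List.length_map, ← ha, h1, h2, hlen']

theorem sum_stackSortable_two_succ {R : Type*} [AddCommMonoid R] (Φ : List ℕ → R) (n : ℕ) :
    ∑ τ ∈ stackSortable 2 (n + 1), Φ τ = ∑ p ∈ Finset.HasAntidiagonal.antidiagonal n,
      ∑ A ∈ stackSortable 2 p.1, ∑ B ∈ stackSortable 2 p.2, ∑ k ∈ interleavings A B,
        Φ (glue A B k) := by
  simp only [Finset.sum_sigma']
  symm
  refine Finset.sum_bij (fun s _ => glue s.2.1 s.2.2.1 s.2.2.2) ?_ ?_ ?_ (fun _ _ => rfl)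
  · rintro ⟨⟨a, b⟩, A, B, k⟩ h
    simp only [Finset.mem_sigma, Finset.HasAntidiagonal.mem_antidiagonal] at h
    obtain ⟨rfl, hA, hB, hk⟩ := h
    exact glue_mem hA hB hk
  · rintro ⟨⟨a, b⟩, A, B, k⟩ h ⟨⟨a', b'⟩, A', B', k'⟩ h' heq
    simp only [Finset.mem_sigma, Finset.HasAntidiagonal.mem_antidiagonal] at h h'
    obtain ⟨h1, hA, hB, hk⟩ := h
    obtain ⟨h1', hA', hB', hk'⟩ := h'
    rw [mem_stackSortable] at hA hB hA' hB'
    obtain ⟨rfl, rfl, rfl⟩ := glue_injective hA.1 hB.1 hk hA'.1 hB'.1 hk' heq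
    have h2 := length_of_mem_permWords hA.1
    have h3 := length_of_mem_permWords hA'.1
    have h4 := length_of_mem_permWords hB.1
    have h5 := length_of_mem_permWords hB'.1
    obtain rfl : a = a' := by omega
    obtain rfl : b = b' := by omega
    rfl
  · intro τ hτ
    obtain ⟨a, b, A, B, k, h1, hA, hB, hk, h⟩ := exists_glue_eq hτ
    exact ⟨⟨(a, b), A, B, k⟩, by simp [h1, hA, hB, hk], h⟩

/-! ### Cuts and tree counts of a glued word. -/

theorem length_mem_cuts {n : ℕ} {τ : List ℕ} (h : τ ∈ permWords n) : n ∈ cuts τ := by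
  rw [mem_cuts, length_of_mem_permWords h]
  refine ⟨le_rfl, pairwise_of_forall_mem fun u hu v hv hh => ?_⟩
  rw [(stackSort_perm τ).mem_iff] at hu
  have := (mem_of_mem_permWords h).1 hu
  omega

theorem one_le_card_cuts {n : ℕ} {τ : List ℕ} (h : τ ∈ permWords n) : 1 ≤ (cuts τ).card :=
  Finset.card_pos.2 ⟨n, length_mem_cuts h⟩

theorem cuts_nil : cuts [] = {0} := by
  ext k
  simp [mem_cuts]

theorem card_cuts_le (τ : List ℕ) : (cuts τ).card ≤ τ.length + 1 :=
  (Finset.card_filter_le _ _).trans (by simp)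

section
variable {a b k : ℕ} {A B : List ℕ}

theorem mem_cuts_map_relabelRight (hB : B ∈ permWords b) {q : ℕ} (hkq : k ≤ q) :
    ((stackSort B).map (relabelRight a k)).Pairwise (fun v w => ¬(w ≤ a + q ∧ a + q < v)) ↔
      (stackSort B).Pairwise (fun v w => ¬(w ≤ q ∧ q < v)) := by
  rw [List.pairwise_map]
  refine List.Pairwise.iff_of_mem fun {v w} hv hw => ?_
  rw [(stackSort_perm B).mem_iff] at hv hw
  have := (mem_of_mem_permWords hB).1 hv
  have := (mem_of_mem_permWords hB).1 hw
  unfold relabelRight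
  split_ifs <;> omega

theorem cuts_glue_nil (hB : B ∈ permWords b) :
    (cuts (glue [] B 0)).card = (cuts B).card + 1 := by
  have hA : ([] : List ℕ) ∈ permWords 0 := by simp [mem_permWords]
  have hk : 0 ∈ interleavings [] B := by simp [interleavings]
  have hlb := length_of_mem_permWords hB
  have : cuts (glue [] B 0) = insert (b + 1) (cuts B) := by
    ext q
    rw [Finset.mem_insert, mem_cuts, mem_cuts, stackSort_glue hA hB hk, length_glue, hlb]
    have h1 := mem_cuts_map_relabelRight (a := 0) (k := 0) hB (Nat.zero_le q)
    simp only [zero_add] at h1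
    simp only [stackSort_nil, List.map_nil, List.nil_append, List.length_nil, zero_add,
      List.pairwise_append, h1, List.pairwise_singleton, true_and, List.mem_singleton, forall_eq]
    constructor
    · rintro ⟨h2, h3, h4⟩
      by_cases hq : q = b + 1
      · exact Or.inl hq
      · exact Or.inr ⟨by omega, h3⟩
    · rintro (rfl | ⟨h2, h3⟩)
      · refine ⟨le_rfl, pairwise_of_forall_mem fun u hu v hv hh => ?_, fun u hu hh => ?_⟩
        · rw [(stackSort_perm B).mem_iff] at hu
          have := (mem_of_mem_permWords hB).1 hu
          omega
        · obtain ⟨v, hv, rfl⟩ := List.mem_map.1 hu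
          rw [(stackSort_perm B).mem_iff] at hv
          have := (mem_of_mem_permWords hB).1 hv
          unfold relabelRight at hh
          split_ifs at hh <;> omega
      · exact ⟨by omega, h3, fun u hu hh => by omega⟩
  rw [this, Finset.card_insert_of_notMem]
  intro h
  have := (mem_cuts.1 h).1
  omega

/-- Here `s(glue A B k)` is `C`, then `a + k`, then the relabelled `s(B)`, then the maximum. A
position `q` with `a ≤ q < a + k` fails, since `a + k` precedes the letter `a` coming from the least
letter of `B`. -/
theorem mem_cuts_glue (hA : A ∈ permWords a) (hB : B ∈ permWords b) (hAe : A ≠ [])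
    (hk : k ∈ cuts B) (q : ℕ) : q ∈ cuts (glue A B k) ↔
      (q < a ∧ q ∈ cuts A) ∨ (∃ r, q = a + r ∧ k ≤ r ∧ r ∈ cuts B) ∨ q = a + b + 1 := by
  have hla := length_of_mem_permWords hA
  have hlb := length_of_mem_permWords hB
  have hk' : k ∈ interleavings A B := by rwa [interleavings, if_neg hAe]
  have hkb : k ≤ b := hlb ▸ (mem_cuts.1 hk).1
  obtain ⟨C, hC, hCa, ha, hC1⟩ := stackSort_eq_append_length hA hAe
  have hL : (stackSort A).map (relabelLeft a k) = C ++ [a + k] := by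
    rw [hC, List.map_append]
    congr 1
    · refine List.map_congr_left (g := id) (fun v hv => ?_) |>.trans (by simp)
      have := hCa v hv
      simp [relabelLeft, this.ne]
    · simp [relabelLeft]
  have hR : ∀ v ∈ (stackSort B).map (relabelRight a k), a ≤ v ∧ v ≤ a + b := by
    intro v hv
    obtain ⟨u, hu, rfl⟩ := List.mem_map.1 hv
    rw [(stackSort_perm B).mem_iff] at hu
    have := (mem_of_mem_permWords hB).1 hu
    unfold relabelRight
    split_ifs <;> omega
  have hone : 1 ≤ k → a ∈ (stackSort B).map (relabelRight a k) := by
    intro h1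
    refine List.mem_map.2 ⟨1, ?_, by simp [relabelRight, h1]⟩
    rw [(stackSort_perm B).mem_iff, mem_of_mem_permWords hB]
    omega
  rw [mem_cuts, stackSort_glue hA hB hk', length_glue, hla, hlb, hL]
  have hmA : q ∈ cuts A ↔ q ≤ a ∧ (C ++ [a]).Pairwise (fun v w => ¬(w ≤ q ∧ q < v)) := by
    rw [mem_cuts, hla, hC]
  have hmr := fun r => @mem_cuts_map_relabelRight a b k B hB r
  generalize hS : (stackSort B).map (relabelRight a k) = S at hR hone hmr ⊢
  simp only [List.pairwise_append, List.pairwise_singleton, true_and, List.mem_singleton,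
    forall_eq, List.mem_append] at hmA ⊢
  constructor
  · rintro ⟨h1, ⟨⟨h2, h3⟩, h4, h5⟩, h6⟩
    rcases lt_or_ge q a with hqa | hqa
    · exact Or.inl ⟨hqa, hmA.2 ⟨hqa.le, h2, fun v hv hh => by omega⟩⟩
    · rcases Nat.lt_or_ge (a + b) q with hq | hq
      · exact Or.inr (Or.inr (by omega))
      · have hkq : k ≤ q - a := by
          by_contra hlt
          have := h5 (a + k) (Or.inr rfl) a (hone (by omega))
          omega
        refine Or.inr (Or.inl ⟨q - a, by omega, hkq, mem_cuts.2 ⟨by omega, ?_⟩⟩)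
        rw [← hmr (q - a) hkq]
        refine h4.imp fun {v w} h => by omega
  · rintro (⟨h1, h2⟩ | ⟨r, rfl, h2, h3⟩ | rfl)
    · obtain ⟨-, h3, h4⟩ := hmA.1 h2
      refine ⟨by omega, ⟨⟨h3, fun v hv hh => by omega⟩, ?_, ?_⟩, ?_⟩
      · exact pairwise_of_forall_mem fun u hu v hv hh => by have := hR v hv; omega
      · intro u hu v hv hh
        have := hR v hv
        omega
      · intro u hu hh
        omega
    · rw [mem_cuts] at h3
      refine ⟨by omega, ⟨⟨?_, fun v hv hh => ?_⟩, (hmr r h2).2 h3.2, ?_⟩, ?_⟩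
      · exact pairwise_of_forall_mem fun u hu v hv hh => by have := hCa u hu; omega
      · have := hCa v hv; omega
      · rintro u (hu | rfl) v hv hh
        · have := hCa u hu; omega
        · omega
      · intro u hu hh
        omega
    · refine ⟨by omega, ⟨⟨?_, fun v hv hh => ?_⟩, ?_, ?_⟩, ?_⟩
      · exact pairwise_of_forall_mem fun u hu v hv hh => by have := hCa u hu; omega
      · have := hCa v hv; omega
      · exact pairwise_of_forall_mem fun u hu v hv hh => by have := hR u hu; omega
      · rintro u (hu | rfl) v hv hh
        · have := hCa u hu; omega
        · omega
      · rintro u ((hu | rfl) | hu) hh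
        · have := hCa u hu; omega
        · omega
        · have := hR u hu; omega

/-- The cut `a` of `A` is traded for the top cut `a + b + 1`, so the cuts of `A` keep their number;
of those of `B` the ones from `k` on survive. -/
theorem card_cuts_glue (hA : A ∈ permWords a) (hB : B ∈ permWords b) (hAe : A ≠ [])
    (hk : k ∈ cuts B) : (cuts (glue A B k)).card =
      (cuts A).card + ((cuts B).filter fun q => k ≤ q).card := by
  have hla := length_of_mem_permWords hA
  have hlb := length_of_mem_permWords hB
  have h1 : cuts A = insert a ((cuts A).filter (· < a)) := by
    ext q
    rw [Finset.mem_insert, Finset.mem_filter]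
    constructor
    · intro h
      have := (mem_cuts.1 h).1
      rcases Nat.lt_or_ge q a with h' | h'
      · exact Or.inr ⟨h, h'⟩
      · exact Or.inl (by omega)
    · rintro (rfl | h)
      · exact length_mem_cuts hA
      · exact h.1
  have h2 : cuts (glue A B k) = insert (a + b + 1)
      ((cuts A).filter (· < a) ∪ ((cuts B).filter fun q => k ≤ q).image (a + ·)) := by
    ext q
    rw [mem_cuts_glue hA hB hAe hk, Finset.mem_insert, Finset.mem_union, Finset.mem_filter,
      Finset.mem_image]
    simp only [Finset.mem_filter]
    constructor
    · rintro (h | ⟨r, rfl, h⟩ | h)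
      · exact Or.inr (Or.inl h.symm)
      · exact Or.inr (Or.inr ⟨r, h.symm, rfl⟩)
      · exact Or.inl h
    · rintro (h | h | ⟨r, h, rfl⟩)
      · exact Or.inr (Or.inr h)
      · exact Or.inl h.symm
      · exact Or.inr (Or.inl ⟨r, rfl, h.symm⟩)
  have h3 : (cuts A).card = ((cuts A).filter (· < a)).card + 1 := by
    conv_lhs => rw [h1]
    rw [Finset.card_insert_of_notMem (by simp)]
  rw [h2, Finset.card_insert_of_notMem, Finset.card_union_of_disjoint,
    Finset.card_image_of_injective _ (fun u v h => Nat.add_left_cancel h), h3]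
  · omega
  · rw [Finset.disjoint_left]
    intro q hq hq'
    obtain ⟨r, -, rfl⟩ := Finset.mem_image.1 hq'
    have := (Finset.mem_filter.1 hq).2
    omega
  · intro h
    rcases Finset.mem_union.1 h with h | h
    · have := (Finset.mem_filter.1 h).2
      omega
    · obtain ⟨r, hr, h⟩ := Finset.mem_image.1 h
      have := (mem_cuts.1 (Finset.mem_filter.1 hr).1).1
      omega

/-- As `k` runs through `S` in increasing order, the exponent runs from `S.card` down to 1. -/
theorem sum_pow_card_filter_le {R : Type*} [CommSemiring R] (y : R) (S : Finset ℕ) :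
    ∑ k ∈ S, y ^ (S.filter fun q => k ≤ q).card = ∑ i ∈ Finset.range S.card, y ^ (i + 1) := by
  induction S using Finset.induction_on_min with
  | empty => simp
  | insert m S hm ih =>
    have hmS : m ∉ S := fun h => lt_irrefl _ (hm m h)
    rw [Finset.sum_insert hmS, Finset.card_insert_of_notMem hmS, Finset.sum_range_succ, ← ih,
      add_comm]
    congr 1
    · refine Finset.sum_congr rfl fun k hk => ?_
      rw [Finset.filter_insert, if_neg (by have := hm k hk; omega)]
    · rw [Finset.filter_true_of_mem, Finset.card_insert_of_notMem hmS]
      intro q hq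
      rcases Finset.mem_insert.1 hq with rfl | hq
      · exact le_rfl
      · exact (hm q hq).le

variable {R : Type*} [CommSemiring R] (α β x : R)

theorem map_range'_of_shift {g : ℕ → ℕ} {c : ℕ} (s n d : ℕ) (hg : ∀ v, c ≤ v → g v = v + d)
    (hs : c ≤ s) : (List.range' s n).map g = List.range' (s + d) n := by
  rw [List.map_congr_left (g := (d + ·)), List.map_add_range', add_comm]
  intro v hv
  rw [List.mem_range'_1] at hv
  rw [hg v (by omega), add_comm]

theorem treeSum_glue_nil (hA : A ∈ permWords a) (l : ℕ) :
    treeSum α β x (glue A [] 0 ++ List.range' (a + 0 + 1 + 1) l) =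
      treeSum α β x (A ++ List.range' (a + 1) (l + 1)) := by
  have : A.map (relabelLeft a 0) = A := by
    refine List.map_congr_left (g := id) (fun v hv => ?_) |>.trans (by simp)
    simp only [relabelLeft, id]
    split_ifs <;> omega
  rw [glue, length_of_mem_permWords hA, this, List.range'_succ]
  simp

/-- `treeSum_decomposition` at the maximum of the glued word. Each factor involves only one of the
two parts, up to an order-preserving relabelling, so `k` drops out; the maximum itself joins the run
after `A`, which has `l - j` letters. -/
theorem treeSum_glue (hA : A ∈ permWords a) (hB : B ∈ permWords b)
    (hk : k ∈ interleavings A B) (hBe : B ≠ []) (l : ℕ) :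
    treeSum α β x (glue A B k ++ List.range' (a + b + 1 + 1) l) =
      x * ∑ j ∈ Finset.range l, treeSum α β x (A ++ List.range' (a + 1) (l - j)) *
        treeSum α β x (B ++ List.range' (b + 1) j) := by
  have hla := length_of_mem_permWords hA
  have hlb := length_of_mem_permWords hB
  have hL := relabelLeft_lt hA hk
  have hR := relabelRight_lt (A := A) (k := k) hB
  have hkb := (mem_interleavings hk).1
  rw [hla, hlb] at hL hR
  rw [glue, List.append_assoc, List.cons_append, hla, hlb,
    treeSum_decomposition α β x (by simpa using hBe) hR _ _ hL List.pairwise_lt_range',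
    List.length_range']
  · congr 1
    refine Finset.sum_congr rfl fun j hj => ?_
    have hj := Finset.mem_range.1 hj
    congr 1
    · let g : ℕ → ℕ := fun v =>
        if v ≤ a then relabelLeft a k v else if v = a + 1 then v + b else v + (b + j + 1)
      rw [← treeSum_map α β x g (A ++ List.range' (a + 1) (l - j))]
      · congr 1
        obtain ⟨i, hi⟩ : ∃ i, l - j = i + 1 := ⟨l - j - 1, by omega⟩
        rw [hi, List.map_append, List.range'_succ, List.map_cons,
          map_range'_of_shift (c := a + 2) _ _ (b + j + 1) _ (by omega)]
        · congr 1
          · refine List.map_congr_left fun v hv => ?_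
            have := (mem_of_mem_permWords hA).1 hv
            simp [g, this.2]
          · congr 1
            · simp [g]; omega
            · rw [List.drop_range']
              congr 1 <;> omega
        · intro v hv
          simp only [g]
          rw [if_neg (by omega), if_neg (by omega)]
      · intro u hu v hv
        simp only [g, relabelLeft]
        split_ifs <;> omega
    · let g : ℕ → ℕ := fun v => if v ≤ b then relabelRight a k v else v + (a + 1)
      rw [← treeSum_map α β x g (B ++ List.range' (b + 1) j)]
      · congr 1
        rw [List.map_append, map_range'_of_shift (c := b + 1) _ _ (a + 1) _ (by omega)]
        · congr 1
          · refine List.map_congr_left fun v hv => ?_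
            have := (mem_of_mem_permWords hB).1 hv
            simp [g, this.2]
          · have h : List.range' (a + b + 1 + 1) l = List.range' (a + b + 1 + 1) j ++
                List.range' (a + b + 1 + 1 + j) (l - j) := by
              rw [List.range'_append_1]
              congr 1
              omega
            rw [h, List.take_left' (by simp)]
            congr 1
            omega
        · intro v hv
          simp only [g]
          rw [if_neg (by omega)]
      · intro u hu v hv
        have h1 : ∀ v ∈ B ++ List.range' (b + 1) j, 1 ≤ v := by
          intro v hv
          rcases List.mem_append.1 hv with hv | hv
          · exact ((mem_of_mem_permWords hB).1 hv).1
          · rw [List.mem_range'_1] at hv; omega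
        have := h1 u hu
        have := h1 v hv
        simp only [g, relabelRight]
        split_ifs <;> omega
  · intro v hv
    rw [List.mem_range'_1] at hv
    omega
end

/-! ### The generating polynomials and their recurrence. -/

open Polynomial

section
variable {R : Type*} [CommSemiring R] (α β x : R)

/-- The operator `p ↦ ((1 + X) p - p(0)) / X` if `a ≠ 0`, and the identity if `a = 0`. -/
noncomputable def cutShift (a : ℕ) (p : R[X]) : R[X] := if a = 0 then p else divX ((1 + X) * p)

/-- The weighted count of the trees whose postorder is a word of `stackSortable 2 m` followed by
an increasing run of `l` entries, where `1 + X` marks the cuts. -/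
noncomputable def sortSeries (l m : ℕ) : R[X] :=
  ∑ τ ∈ stackSortable 2 m,
    C (treeSum α β x (τ ++ List.range' (m + 1) l)) * (1 + X) ^ ((cuts τ).card - 1)

theorem stackSortable_two_zero : stackSortable 2 0 = {[]} := by
  ext τ
  rw [mem_stackSortable_two, mem_permWords]
  simp only [List.range'_zero, List.perm_nil, Finset.mem_singleton, and_iff_left_iff_imp]
  rintro rfl
  simp [Avoids231]

theorem sortSeries_zero (l : ℕ) :
    sortSeries α β x l 0 = C (treeSum α β x (List.range' 1 l)) := by
  rw [sortSeries, stackSortable_two_zero]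
  simp [cuts_nil]

theorem divX_sum {ι : Type*} (s : Finset ι) (f : ι → R[X]) :
    divX (∑ i ∈ s, f i) = ∑ i ∈ s, divX (f i) :=
  map_sum (divX_hom (R := R)) f s

theorem cutShift_sum {ι : Type*} (a : ℕ) (s : Finset ι) (f : ι → R[X]) :
    cutShift a (∑ i ∈ s, f i) = ∑ i ∈ s, cutShift a (f i) := by
  unfold cutShift
  split_ifs
  · rfl
  · rw [Finset.mul_sum, divX_sum]

theorem cutShift_C_mul (a : ℕ) (r : R) (p : R[X]) : cutShift a (C r * p) = C r * cutShift a p := by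
  unfold cutShift
  split_ifs
  · rfl
  · rw [← divX_C_mul, mul_left_comm]

/-- The geometric sum `((1 + X) ^ n - 1) / X`. Marking cuts by `1 + X` is what makes the sum over
interleavings a mere shift of coefficients. -/
theorem divX_one_add_X_pow (n : ℕ) :
    divX ((1 + X : R[X]) ^ n) = ∑ i ∈ Finset.range n, (1 + X) ^ i := by
  induction n with
  | zero => simp
  | succ n ih =>
    rw [Finset.sum_range_succ, ← ih, pow_succ, mul_add, mul_one, divX_add]
    congr 1
    ext i
    simp [coeff_divX]

theorem sum_pow_card_cuts_glue {a b : ℕ} {A B : List ℕ} (hA : A ∈ permWords a)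
    (hB : B ∈ permWords b) :
    ∑ k ∈ interleavings A B, (1 + X : R[X]) ^ ((cuts (glue A B k)).card - 1) =
      (1 + X) * (1 + X) ^ ((cuts A).card - 1) * cutShift a ((1 + X) ^ ((cuts B).card - 1)) := by
  have hcB := one_le_card_cuts hB
  have hcA := one_le_card_cuts hA
  have hla := length_of_mem_permWords hA
  by_cases hAe : A = []
  · subst hAe
    obtain rfl : 0 = a := by simpa using hla
    rw [interleavings, if_pos rfl, Finset.sum_singleton, cuts_glue_nil hB, cutShift, if_pos rfl,
      cuts_nil, Finset.card_singleton, Nat.sub_self, pow_zero, mul_one, ← pow_succ']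
    congr 1
    omega
  · have ha : a ≠ 0 := by
      rintro rfl
      exact hAe (List.length_eq_zero_iff.1 hla)
    rw [interleavings, if_neg hAe, cutShift, if_neg ha, ← pow_succ', ← pow_succ',
      Nat.sub_add_cancel hcB, divX_one_add_X_pow, Finset.mul_sum]
    have : ∀ k ∈ cuts B, (1 + X : R[X]) ^ ((cuts (glue A B k)).card - 1) =
        (1 + X) ^ ((cuts A).card - 1) * (1 + X) ^ ((cuts B).filter fun q => k ≤ q).card := by
      intro k hk
      rw [card_cuts_glue hA hB hAe hk, ← pow_add]
      congr 1
      omega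
    rw [Finset.sum_congr rfl this, ← Finset.mul_sum, sum_pow_card_filter_le, Finset.mul_sum]
    refine Finset.sum_congr rfl fun i _ => ?_
    rw [← pow_add, ← pow_add]
    congr 1
    omega

/-- The first term comes from an empty right part, where the maximum just lengthens the run
(`treeSum_glue_nil`). For a nonempty right part, `treeSum_glue` factors the tree count and
`sum_pow_card_cuts_glue` the cut statistic. -/
theorem sortSeries_succ (l m : ℕ) :
    sortSeries α β x l (m + 1) = (1 + X) * (sortSeries α β x (l + 1) m +
      C x * ∑ a ∈ Finset.range m, ∑ j ∈ Finset.range l,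
        sortSeries α β x (l - j) a * cutShift a (sortSeries α β x j (m - a))) := by
  rw [sortSeries, sum_stackSortable_two_succ, Finset.Nat.sum_antidiagonal_eq_sum_range_succ_mk,
    Finset.sum_range_succ, add_comm, mul_add]
  congr 1
  · simp only [Nat.sub_self, stackSortable_two_zero, Finset.sum_singleton]
    rw [sortSeries, Finset.mul_sum]
    refine Finset.sum_congr rfl fun A hA => ?_
    have hA := (mem_stackSortable.1 hA).1
    have hB : ([] : List ℕ) ∈ permWords 0 := by simp [mem_permWords]
    have hi : interleavings A [] = {0} := by
      unfold interleavings
      split_ifs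
      · rfl
      · exact cuts_nil
    have h1 := sum_pow_card_cuts_glue (R := R) hA hB
    have h2 : cutShift m ((1 + X : R[X]) ^ ((cuts []).card - 1)) = 1 := by
      rw [cuts_nil]
      unfold cutShift
      split_ifs
      · simp
      · ext i
        simp [coeff_divX, coeff_X, coeff_one]
    rw [hi, Finset.sum_singleton, h2, mul_one] at h1
    rw [hi, Finset.sum_singleton, h1]
    have := treeSum_glue_nil α β x hA l
    rw [add_zero] at this
    rw [this]
    ring
  · rw [Finset.mul_sum, Finset.mul_sum]
    refine Finset.sum_congr rfl fun a ha => ?_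
    have ha := Finset.mem_range.1 ha
    have hterm : ∀ A ∈ stackSortable 2 a, ∀ B ∈ stackSortable 2 (m - a),
        ∑ k ∈ interleavings A B, C (treeSum α β x (glue A B k ++ List.range' (m + 1 + 1) l)) *
          (1 + X) ^ ((cuts (glue A B k)).card - 1) =
        (1 + X) * (C x * ∑ j ∈ Finset.range l,
          (C (treeSum α β x (A ++ List.range' (a + 1) (l - j))) *
            (1 + X) ^ ((cuts A).card - 1)) *
          cutShift a (C (treeSum α β x (B ++ List.range' (m - a + 1) j)) *
            (1 + X) ^ ((cuts B).card - 1))) := by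
      intro A hA B hB
      have hA := (mem_stackSortable.1 hA).1
      have hB := (mem_stackSortable.1 hB).1
      have hBe : B ≠ [] := by
        rintro rfl
        have := length_of_mem_permWords hB
        simp at this
        omega
      have h1 : ∀ k ∈ interleavings A B,
          C (treeSum α β x (glue A B k ++ List.range' (m + 1 + 1) l)) *
            (1 + X) ^ ((cuts (glue A B k)).card - 1) =
          C (x * ∑ j ∈ Finset.range l, treeSum α β x (A ++ List.range' (a + 1) (l - j)) *
            treeSum α β x (B ++ List.range' (m - a + 1) j)) *
            (1 + X) ^ ((cuts (glue A B k)).card - 1) := by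
        intro k hk
        have := treeSum_glue α β x hA hB hk hBe l
        rw [show a + (m - a) + 1 = m + 1 by omega] at this
        rw [this]
      rw [Finset.sum_congr rfl h1, ← Finset.mul_sum, sum_pow_card_cuts_glue hA hB]
      simp only [cutShift_C_mul, map_mul, map_sum, Finset.mul_sum, Finset.sum_mul]
      refine Finset.sum_congr rfl fun j _ => ?_
      ring
    rw [Finset.sum_congr rfl fun A hA => Finset.sum_congr rfl (hterm A hA)]
    simp only [← Finset.mul_sum]
    congr 2
    rw [Finset.sum_congr rfl fun A _ => Finset.sum_comm, Finset.sum_comm]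
    refine Finset.sum_congr rfl fun j _ => ?_
    rw [sortSeries, sortSeries, cutShift_sum, Finset.sum_mul_sum]

end

/-! ### Homogeneity of the tree weights and the γ-polynomial. -/

section
variable {R : Type*} [CommSemiring R] (α β x : R)

theorem treeSum_range' (s n : ℕ) :
    treeSum α β x (List.range' (s + 1) n) = treeSum α β x (List.range' 1 n) := by
  rw [← treeSum_map α β x (· + s) (List.range' 1 n) (by simp)]
  rw [map_range'_of_shift (c := 0) 1 n s (by simp) (by omega), add_comm]

theorem treeSum_range'_succ_succ (l : ℕ) :
    treeSum α β x (List.range' 1 (l + 2)) = (α + β) * treeSum α β x (List.range' 1 (l + 1)) +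
      x * ∑ i ∈ Finset.range l, treeSum α β x (List.range' 1 (i + 1)) *
        treeSum α β x (List.range' 1 (l - i)) := by
  have h1 : List.range' 1 (l + 2) = List.range' 1 (l + 1) ++ [l + 2] := by
    rw [List.range'_1_concat]
    congr 2
    omega
  rw [h1, treeSum_append_singleton_of_lt, splitSum, List.length_range', Finset.sum_range_succ,
    Finset.sum_range_succ']
  · have h2 : ∀ i ∈ Finset.range l,
        nodeWeight α β x ((List.range' 1 (l + 1)).take (i + 1))
          ((List.range' 1 (l + 1)).drop (i + 1)) *
        treeSum α β x ((List.range' 1 (l + 1)).take (i + 1)) *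
        treeSum α β x ((List.range' 1 (l + 1)).drop (i + 1)) =
        x * (treeSum α β x (List.range' 1 (i + 1)) * treeSum α β x (List.range' 1 (l - i))) := by
      intro i hi
      have hi := Finset.mem_range.1 hi
      have h : List.range' 1 (l + 1) = List.range' 1 (i + 1) ++ List.range' (i + 1 + 1) (l - i) := by
        rw [add_comm (i + 1) 1, List.range'_append_1]
        congr 1
        omega
      rw [h, List.take_left' (by simp), List.drop_left' (by simp), nodeWeight_ne_nil,
        mul_assoc]
      · rw [treeSum_range' α β x (i + 1)]
      · simp
      · rw [Ne, List.range'_eq_nil_iff]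
        omega
    rw [Finset.sum_congr rfl h2, ← Finset.mul_sum]
    have h3 : (List.range' 1 (l + 1)).drop (l + 1) = [] := by simp
    have h4 : (List.range' 1 (l + 1)).take (l + 1) = List.range' 1 (l + 1) := by simp
    rw [h3, h4]
    simp [nodeWeight]
    ring
  · intro u hu
    rw [List.mem_range'_1] at hu
    omega

theorem sum_treeSum_eq_coeff (m : ℕ) :
    ∑ τ ∈ stackSortable 2 m, treeSum α β x τ = (sortSeries α β x 0 m).coeff 0 := by
  rw [sortSeries, finsetSum_coeff]
  refine Finset.sum_congr rfl fun τ _ => ?_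
  simp [coeff_zero_eq_eval_zero]

variable {α β x} {α' β' x' e : R}

/-- A tree on `l + 1` nodes has `l` edges, one below each one-child node and two below each
two-child node. Only `α + β` enters because the postorder does not record the side of an only child.
-/
theorem treeSum_range'_homogeneous (h1 : α + β = e * (α' + β')) (h2 : x = e ^ 2 * x') (l : ℕ) :
    treeSum α β x (List.range' 1 (l + 1)) = e ^ l * treeSum α' β' x' (List.range' 1 (l + 1)) := by
  induction l using Nat.strong_induction_on with
  | _ l ih =>
    rcases l with _ | l
    · simp [treeSum_singleton]
    · rw [treeSum_range'_succ_succ, treeSum_range'_succ_succ, ih l (by omega), h1,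
        mul_add (e ^ (l + 1)), Finset.mul_sum, Finset.mul_sum, Finset.mul_sum]
      congr 1
      · ring
      · refine Finset.sum_congr rfl fun i hi => ?_
        have hi := Finset.mem_range.1 hi
        obtain ⟨j, rfl⟩ : ∃ j, l = i + j + 1 := ⟨l - i - 1, by omega⟩
        rw [show i + j + 1 - i = j + 1 by omega, ih i (by omega), ih j (by omega), h2]
        ring

theorem sortSeries_homogeneous (h1 : α + β = e * (α' + β')) (h2 : x = e ^ 2 * x') (m l : ℕ)
    (hlm : 1 ≤ l + m) :
    sortSeries α β x l m = C (e ^ (l + m - 1)) * sortSeries α' β' x' l m := by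
  induction m using Nat.strong_induction_on generalizing l with
  | _ m ih =>
    rcases m with _ | m
    · obtain ⟨l, rfl⟩ : ∃ i, l = i + 1 := ⟨l - 1, by omega⟩
      rw [sortSeries_zero, sortSeries_zero, treeSum_range'_homogeneous h1 h2, C_mul]
      simp
    · rw [sortSeries_succ, sortSeries_succ, ih m (by omega) (l + 1) (by omega), mul_left_comm]
      congr 1
      rw [mul_add]
      congr 1
      · congr 3
        omega
      · rw [Finset.mul_sum, Finset.mul_sum, Finset.mul_sum]
        refine Finset.sum_congr rfl fun a ha => ?_
        rw [Finset.mul_sum, Finset.mul_sum, Finset.mul_sum]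
        refine Finset.sum_congr rfl fun j hj => ?_
        have ha := Finset.mem_range.1 ha
        have hj := Finset.mem_range.1 hj
        rw [ih a (by omega) (l - j) (by omega), ih (m - a) (by omega) j (by omega), h2,
          cutShift_C_mul]
        have : l + (m + 1) - 1 = 2 + (l - j + a - 1) + (j + (m - a) - 1) := by omega
        rw [this, pow_add, pow_add]
        simp only [C_mul]
        ring
end

/-- The polynomial with coefficients the γ-vector of the descent polynomial of the
`3`-stack-sortable permutations. -/
noncomputable def gammaPoly (n : ℕ) : ℕ[X] := ∑ τ ∈ stackSortable 2 n, treeSum 1 0 X τ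

theorem aeval_gammaPoly {A : Type*} [CommSemiring A] (t : A) (n : ℕ) :
    aeval t (gammaPoly n) = ∑ τ ∈ stackSortable 2 n, treeSum 1 0 t τ := by
  rw [gammaPoly, map_sum]
  refine Finset.sum_congr rfl fun τ _ => ?_
  have := map_treeSum (1 : ℕ[X]) 0 X (aeval (R := ℕ) t : ℕ[X] →ₐ[ℕ] A).toRingHom τ
  simpa using this

/-- Homogeneity with `e = 1 + z` moves the weights `1, z, z` to `1, 0, z / (1 + z) ^ 2`. -/
theorem aeval_descentPoly_eq_gammaPoly (n : ℕ) (hn : 1 ≤ n) (z : ℂ) (hz : 1 + z ≠ 0) :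
    aeval z (descentPoly 3 n) = (1 + z) ^ (n - 1) * aeval (z / (1 + z) ^ 2) (gammaPoly n) := by
  rw [aeval_descentPoly, aeval_gammaPoly, sum_treeSum_eq_coeff, sum_treeSum_eq_coeff,
    sortSeries_homogeneous (e := 1 + z) (α' := 1) (β' := 0) (x' := z / (1 + z) ^ 2) (by simp)
      (by field_simp) n 0 (by omega), coeff_C_mul, zero_add]

/-! ### Size bounds for the packed computation. -/

theorem catalan_le_four_pow (n : ℕ) : catalan n ≤ 4 ^ n := by
  rw [catalan_eq_centralBinom_div, show 4 = 2 ^ 2 by rfl, ← pow_mul]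
  exact (Nat.div_le_self _ _).trans (Nat.choose_le_two_pow _ _)

/-- At most `catalan n` trees count, each with at most `(n - 1) / 2` two-child nodes. Taking a
square `S ^ 2` as the weight avoids halving the exponent. -/
theorem treeSum_le (S : ℕ) (hS : 1 ≤ S) (τ : List ℕ) :
    treeSum 1 0 (S ^ 2) τ ≤ S ^ (τ.length - 1) * catalan τ.length := by
  induction hn : τ.length using Nat.strong_induction_on generalizing τ with
  | _ n ih =>
    rcases List.eq_nil_or_concat τ with rfl | ⟨p, M, rfl⟩
    · subst hn
      simp
    · rw [List.concat_eq_append] at hn ⊢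
      obtain rfl : n = p.length + 1 := by simpa using hn.symm
      rw [treeSum_append_singleton]
      split_ifs with h
      · rw [catalan_succ', Finset.Nat.sum_antidiagonal_eq_sum_range_succ_mk, splitSum,
          Finset.mul_sum]
        refine Finset.sum_le_sum fun i hi => ?_
        have hi := Finset.mem_range.1 hi
        have h1 := ih i (by omega) (p.take i) (by simp; omega)
        have h2 := ih (p.length - i) (by omega) (p.drop i) (by simp)
        have hw : nodeWeight 1 0 (S ^ 2) (p.take i) (p.drop i) * S ^ (i - 1) *
            S ^ (p.length - i - 1) ≤ S ^ p.length := by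
          have e1 : p.take i = [] ↔ i = 0 := by
            rw [← List.length_eq_zero_iff, List.length_take, min_eq_left (by omega)]
          have e2 : p.drop i = [] ↔ p.length - i = 0 := by
            rw [← List.length_eq_zero_iff, List.length_drop]
          unfold nodeWeight
          simp only [e1, e2]
          split_ifs with h3 h4 h4
          · simp only [one_mul, ← pow_add]
            exact Nat.pow_le_pow_right hS (by omega)
          · simp
          · simp only [one_mul, ← pow_add]
            exact Nat.pow_le_pow_right hS (by omega)
          · simp only [← pow_add]
            exact Nat.pow_le_pow_right hS (by omega)
        simp only [Nat.add_sub_cancel]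
        calc _ ≤ nodeWeight 1 0 (S ^ 2) (p.take i) (p.drop i) * (S ^ (i - 1) * catalan i) *
              (S ^ (p.length - i - 1) * catalan (p.length - i)) :=
              Nat.mul_le_mul (Nat.mul_le_mul_left _ h1) h2
          _ = (nodeWeight 1 0 (S ^ 2) (p.take i) (p.drop i) * S ^ (i - 1) *
              S ^ (p.length - i - 1)) * (catalan i * catalan (p.length - i)) := by ring
          _ ≤ _ := Nat.mul_le_mul_right _ hw
      · exact Nat.zero_le _

theorem card_stackSortable_le (t m : ℕ) : (stackSortable t m).card ≤ m.factorial := by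
  refine (Finset.card_filter_le _ _).trans ((List.toFinset_card_le _).trans ?_)
  rw [List.length_permutations, List.length_range']

/-- There are at most `N!` words; the tree count contributes `4 ^ N * S ^ N` and the binomial
coefficient from `1 + X` contributes `2 ^ N`. -/
theorem coeff_sortSeries_le {S : ℕ} (hS : 1 ≤ S) {m N : ℕ} (hm : m ≤ N) (k : ℕ) :
    (sortSeries 1 0 (S ^ 2) 0 m).coeff k ≤ N.factorial * 8 ^ N * S ^ N := by
  have h : ∀ τ ∈ stackSortable 2 m, (C (treeSum 1 0 (S ^ 2) (τ ++ List.range' (m + 1) 0)) *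
      (1 + X) ^ ((cuts τ).card - 1)).coeff k ≤ 8 ^ N * S ^ N := by
    intro τ hτ
    have hl := length_of_mem_permWords (mem_stackSortable.1 hτ).1
    have h1 := treeSum_le S hS τ
    have h2 : ((cuts τ).card - 1).choose k ≤ 2 ^ N := by
      refine (Nat.choose_le_two_pow _ _).trans (Nat.pow_le_pow_right (by norm_num) ?_)
      have := card_cuts_le τ
      omega
    rw [coeff_C_mul, coeff_one_add_X_pow, List.range'_zero, List.append_nil, Nat.cast_id]
    rw [hl] at h1
    calc _ ≤ (S ^ N * 4 ^ N) * 2 ^ N := by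
          refine Nat.mul_le_mul (h1.trans (Nat.mul_le_mul ?_ ?_)) h2
          · exact Nat.pow_le_pow_right hS (by omega)
          · exact (catalan_le_four_pow m).trans (Nat.pow_le_pow_right (by norm_num) hm)
      _ = 8 ^ N * S ^ N := by
          rw [show 8 = 4 * 2 by rfl, mul_pow]
          ring
  rw [sortSeries, finsetSum_coeff]
  refine (Finset.sum_le_card_nsmul _ _ _ h).trans ?_
  rw [smul_eq_mul, mul_assoc]
  exact Nat.mul_le_mul_right _ ((card_stackSortable_le 2 m).trans (Nat.factorial_le hm))

/-! ### The kernel computation. -/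

section

/-- `f n`, written so that the kernel evaluates `n` before it unfolds `f`. -/
def forceNat {α : Type} (n : ℕ) (f : ℕ → α) : α := Nat.rec (f 0) (fun m _ => f (m + 1)) n

/-- `f l`, written so that the kernel evaluates the entries of `l` before it unfolds `f`. -/
def forceList {α : Type} : List ℕ → (List ℕ → α) → α
  | [], f => f []
  | x :: l, f => forceNat x fun y => forceList l fun l' => f (y :: l')

theorem forceNat_eq {α : Type} (n : ℕ) (f : ℕ → α) : forceNat n f = f n := by
  cases n <;> rfl

theorem forceList_eq {α : Type} (l : List ℕ) (f : List ℕ → α) : forceList l f = f l := by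
  induction l generalizing f with
  | nil => rfl
  | cons x l ih => rw [forceList, forceNat_eq, ih]

/-- `f l`, written so that the kernel evaluates the spine of `l` before it unfolds `f`. -/
def forceSpine {α : Type} : List (List ℕ) → (List (List ℕ) → α) → α
  | [], f => f []
  | u :: us, f => forceSpine us fun us' => f (u :: us')

theorem forceSpine_eq {α : Type} (us : List (List ℕ)) (f : List (List ℕ) → α) :
    forceSpine us f = f us := by
  induction us generalizing f with
  | nil => rfl
  | cons u us ih => rw [forceSpine, ih]

/-- The coefficient at `k` of the product of the polynomials with coefficient lists `u`, `v`. -/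
def convCoeff : ℕ → List ℕ → List ℕ → ℕ
  | 0, u, v => u.headD 0 * v.headD 0
  | k + 1, u, v => u.headD 0 * v.getD (k + 1) 0 + convCoeff k u.tail v

theorem convCoeff_eq (k : ℕ) (u v : List ℕ) :
    convCoeff k u v = ∑ i ∈ Finset.range (k + 1), u.getD i 0 * v.getD (k - i) 0 := by
  have hh : ∀ w : List ℕ, w.headD 0 = w.getD 0 0 := fun w => by cases w <;> rfl
  induction k generalizing u with
  | zero => rw [convCoeff, hh, hh]; simp
  | succ k ih =>
    rw [convCoeff, ih, Finset.sum_range_succ' _ (k + 1), hh, add_comm]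
    congr 1
    refine Finset.sum_congr rfl fun i _ => ?_
    have : u.tail.getD i 0 = u.getD (i + 1) 0 := by cases u <;> simp
    rw [this, Nat.add_sub_add_right]

/-- The sum stops at the shorter list; in `runRows` the second list has one more entry, which
belongs to no summand of the recurrence. -/
def convSum (k : ℕ) : List (List ℕ) → List (List ℕ) → ℕ
  | u :: us, v :: vs => convCoeff k u v + convSum k us vs
  | _, _ => 0

theorem convSum_eq (k : ℕ) (us vs : List (List ℕ)) (h : us.length ≤ vs.length) :
    convSum k us vs =
      ∑ a ∈ Finset.range us.length, convCoeff k (us.getD a []) (vs.getD a []) := by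
  induction us generalizing vs with
  | nil => simp [convSum]
  | cons u us ih =>
    cases vs with
    | nil => simp at h
    | cons v vs =>
      rw [convSum, ih vs (by simpa using h), List.length_cons, Finset.sum_range_succ', add_comm]
      simp

/-- The coefficients of `((1 + X) p - p(0)) / X` from those of `p`. -/
def shiftRow : List ℕ → List ℕ
  | [] => []
  | x :: l => (x + l.headD 0) :: shiftRow l

theorem getD_shiftRow (l : List ℕ) (k : ℕ) :
    (shiftRow l).getD k 0 = l.getD k 0 + l.getD (k + 1) 0 := by
  induction l generalizing k with
  | nil => simp [shiftRow]
  | cons x l ih =>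
    cases k with
    | zero => cases l <;> simp [shiftRow]
    | succ k => simpa [shiftRow] using ih k

/-- The coefficients of `(1 + X) p + c` from those of `p`. -/
def mulOneAddX : ℕ → List ℕ → List ℕ
  | _, [] => []
  | c, x :: l => (x + c) :: mulOneAddX x l

theorem getD_mulOneAddX (l : List ℕ) (c k : ℕ) (hk : k < l.length) :
    (mulOneAddX c l).getD k 0 = l.getD k 0 + if k = 0 then c else l.getD (k - 1) 0 := by
  induction l generalizing k c with
  | nil => simp at hk
  | cons x l ih =>
    cases k with
    | zero => simp [mulOneAddX]
    | succ k =>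
      have := ih x k (by simpa using hk)
      simp only [mulOneAddX, List.getD_cons_succ, this, Nat.add_sub_cancel, Nat.add_one_ne_zero,
        if_false]
      cases k <;> simp

/-- Reduction of the entries modulo `Z ^ L`, `Z ^ (L - 2)`, `Z ^ (L - 4)`, …. -/
def modRow (Z : ℕ) : ℕ → List ℕ → List ℕ
  | _, [] => []
  | L, x :: l => x % Z ^ L :: modRow Z (L - 2) l

theorem getD_modRow (Z : ℕ) (l : List ℕ) (L k : ℕ) :
    (modRow Z L l).getD k 0 = l.getD k 0 % Z ^ (L - 2 * k) := by
  induction l generalizing k L with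
  | nil => simp [modRow]
  | cons x l ih =>
    cases k with
    | zero => simp [modRow]
    | succ k =>
      simp only [modRow, List.getD_cons_succ, ih]
      congr 2
      omega

/-- Position `k` holds the coefficient of `X ^ k`, its digits indexed by the run length `l`.
Division by `Z` realizes `l + 1`; the factor `Z` restores the shift of the rows in `us`, which are
stored without their lowest digit because only `l - j ≥ 1` occurs there. -/
def newRow (T Z N m : ℕ) (row : List ℕ) (us vs : List (List ℕ)) : List ℕ :=
  forceList ((List.range ((N - (m + 1)) / 2 + 1)).map fun k =>
    row.getD k 0 / Z + T * Z * convSum k us vs) fun s => modRow Z (N - m) (mulOneAddX 0 s)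

/-- The constant coefficients of the rows after row `m`. -/
def runRows (T Z N : ℕ) : ℕ → ℕ → List ℕ → List (List ℕ) → List (List ℕ) → List ℕ
  | 0, _, _, _, _ => []
  | fuel + 1, m, row, us, ds =>
    forceList (newRow T Z N m row us (row :: ds)) fun row' =>
    forceList (row.map (· / Z)) fun low =>
    forceList (shiftRow row) fun d =>
    forceSpine (us ++ [low]) fun us' =>
    row'.headD 0 % Z :: runRows T Z N fuel (m + 1) row' us' (d :: ds)

/-- The recurrence `treeSum_range'_succ_succ` with `α + β = 1`; the leading `0` lowers the total
index of the convolution by one. -/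
def narayanaTable (T : ℕ) : ℕ → List ℕ → List ℕ
  | 0, w => w
  | f + 1, w =>
    forceNat (w.getD (w.length - 1) 0 + T * convCoeff (w.length - 1) (0 :: w) w) fun y =>
    narayanaTable T f (w ++ [y])

def packDigits (Z : ℕ) : List ℕ → ℕ
  | [] => 0
  | c :: l => c + Z * packDigits Z l

/-- The values at `T` of the first `N` polynomials `gammaPoly`, starting from `gammaPoly 1`. The
computation packs sequences into the digits in base `Z` of natural numbers. -/
def gammaValues (T Z N : ℕ) : List ℕ :=
  forceNat T fun T => forceNat Z fun Z =>
  forceNat (packDigits Z (1 :: narayanaTable T (N - 1) [1])) fun c =>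
  runRows T Z N N 0 [c] [] []

/-! ### Arithmetic of sequences packed into digits. -/

/-- The number `n` has the first `L` digits `f` in base `Z`, up to carries. -/
def Packs (Z L n : ℕ) (f : ℕ → ℕ) : Prop :=
  ∃ g : ℕ[X], n ≡ g.eval Z [MOD Z ^ L] ∧ ∀ l < L, g.coeff l = f l

section
variable {Z L n n' : ℕ} {f f' : ℕ → ℕ}

theorem Packs.mono {L' : ℕ} (h : Packs Z L n f) (hL : L' ≤ L) : Packs Z L' n f := by
  obtain ⟨g, h1, h2⟩ := h
  exact ⟨g, h1.of_dvd (pow_dvd_pow Z hL), fun l hl => h2 l (by omega)⟩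

theorem Packs.congr (h : Packs Z L n f) (hf : ∀ l < L, f l = f' l) : Packs Z L n f' := by
  obtain ⟨g, h1, h2⟩ := h
  exact ⟨g, h1, fun l hl => (h2 l hl).trans (hf l hl)⟩

theorem packs_zero : Packs Z L 0 fun _ => 0 := ⟨0, by simp; rfl, by simp⟩

theorem Packs.add (h : Packs Z L n f) (h' : Packs Z L n' f') :
    Packs Z L (n + n') fun l => f l + f' l := by
  obtain ⟨g, h1, h2⟩ := h
  obtain ⟨g', h1', h2'⟩ := h'
  exact ⟨g + g', by rw [eval_add]; exact h1.add h1', fun l hl => by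
    rw [coeff_add, h2 l hl, h2' l hl]⟩

theorem packs_sum {ι : Type*} (s : Finset ι) (N : ι → ℕ) (F : ι → ℕ → ℕ)
    (h : ∀ i ∈ s, Packs Z L (N i) (F i)) : Packs Z L (∑ i ∈ s, N i) fun l => ∑ i ∈ s, F i l := by
  classical
  induction s using Finset.induction_on with
  | empty => simpa using packs_zero
  | insert i s hi ih =>
    simp only [Finset.sum_insert hi]
    exact (h i (by simp)).add (ih fun j hj => h j (by simp [hj]))

theorem Packs.const_mul (T : ℕ) (h : Packs Z L n f) : Packs Z L (T * n) fun l => T * f l := by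
  obtain ⟨g, h1, h2⟩ := h
  exact ⟨C T * g, by rw [eval_mul, eval_C]; exact h1.mul_left T, fun l hl => by
    rw [coeff_C_mul, h2 l hl]⟩

theorem Packs.mul (h : Packs Z L n f) (h' : Packs Z L n' f') :
    Packs Z L (n * n') fun l => ∑ i ∈ Finset.range (l + 1), f i * f' (l - i) := by
  obtain ⟨g, h1, h2⟩ := h
  obtain ⟨g', h1', h2'⟩ := h'
  refine ⟨g * g', by rw [eval_mul]; exact h1.mul h1', fun l hl => ?_⟩
  rw [coeff_mul, Finset.Nat.sum_antidiagonal_eq_sum_range_succ_mk]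
  refine Finset.sum_congr rfl fun i hi => ?_
  have := Finset.mem_range.1 hi
  rw [h2 i (by omega), h2' (l - i) (by omega)]

theorem Packs.base_mul (h : Packs Z L n f) :
    Packs Z (L + 1) (Z * n) fun l => if l = 0 then 0 else f (l - 1) := by
  obtain ⟨g, h1, h2⟩ := h
  refine ⟨X * g, ?_, fun l hl => ?_⟩
  · rw [eval_mul, eval_X, pow_succ']
    exact h1.mul_left' Z
  · cases l with
    | zero => simp
    | succ l => simpa using h2 l (by omega)

theorem Packs.mod (h : Packs Z L n f) : Packs Z L (n % Z ^ L) f := by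
  obtain ⟨g, h1, h2⟩ := h
  exact ⟨g, (Nat.mod_modEq _ _).trans h1, h2⟩

theorem Packs.mod_base (h : Packs Z (L + 1) n f) (hf : f 0 < Z) : n % Z = f 0 := by
  obtain ⟨g, h1, h2⟩ := h
  have h3 := h1.of_dvd (Dvd.intro _ (pow_succ' Z L).symm)
  rw [← X_mul_divX_add g, eval_add, eval_mul, eval_X, eval_C, h2 0 (by omega)] at h3
  have h4 : n % Z = (Z * eval Z g.divX + f 0) % Z := h3
  rwa [Nat.mul_add_mod, Nat.mod_eq_of_lt hf] at h4

/-- Carries among higher digits are never resolved; only the lowest digit has to stay below `Z` for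
the division to be a shift. This is why `coeff_sortSeries_le` is needed only for `l = 0`. -/
theorem Packs.div_base (h : Packs Z (L + 1) n f) (hf : f 0 < Z) :
    Packs Z L (n / Z) fun l => f (l + 1) := by
  have hm := h.mod_base hf
  obtain ⟨g, h1, h2⟩ := h
  refine ⟨divX g, ?_, fun l hl => by rw [coeff_divX, h2 (l + 1) (by omega)]⟩
  have hZ : Z ≠ 0 := by omega
  rw [← X_mul_divX_add g, eval_add, eval_mul, eval_X, eval_C, h2 0 (by omega),
    ← Nat.div_add_mod n Z, hm, pow_succ'] at h1
  exact Nat.ModEq.mul_left_cancel' hZ (Nat.ModEq.add_right_cancel' _ h1)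

end

theorem packs_packDigits (Z L : ℕ) (l : List ℕ) :
    Packs Z L (packDigits Z l) fun i => l.getD i 0 := by
  suffices ∃ g : ℕ[X], packDigits Z l = g.eval Z ∧ ∀ i, g.coeff i = l.getD i 0 by
    obtain ⟨g, h1, h2⟩ := this
    exact ⟨g, by rw [h1], fun i _ => h2 i⟩
  induction l with
  | nil => exact ⟨0, by simp [packDigits]⟩
  | cons c l ih =>
    obtain ⟨g, h1, h2⟩ := ih
    refine ⟨X * g + C c, by simp [packDigits, h1, add_comm], fun i => ?_⟩
    cases i with
    | zero => simp
    | succ i => simp [h2]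

theorem narayanaTable_eq (T f n : ℕ) :
    narayanaTable T f ((List.range (n + 1)).map fun i => treeSum 1 0 T (List.range' 1 (i + 1))) =
      (List.range (n + 1 + f)).map fun i => treeSum 1 0 T (List.range' 1 (i + 1)) := by
  induction f generalizing n with
  | zero => rfl
  | succ f ih =>
    have hg : ∀ i < n + 1, ((List.range (n + 1)).map fun i =>
        treeSum 1 0 T (List.range' 1 (i + 1))).getD i 0 = treeSum 1 0 T (List.range' 1 (i + 1)) := by
      intro i hi
      rw [List.getD_eq_getElem _ _ (by simpa using hi)]
      simp
    have hnew : treeSum 1 0 T (List.range' 1 (n + 2)) =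
        ((List.range (n + 1)).map fun i => treeSum 1 0 T (List.range' 1 (i + 1))).getD n 0 +
        T * convCoeff n (0 :: (List.range (n + 1)).map fun i =>
          treeSum 1 0 T (List.range' 1 (i + 1)))
          ((List.range (n + 1)).map fun i => treeSum 1 0 T (List.range' 1 (i + 1))) := by
      rw [treeSum_range'_succ_succ, convCoeff_eq, Finset.sum_range_succ', hg n (by omega)]
      simp only [List.getD_cons_zero, List.getD_cons_succ, zero_mul, add_zero, one_mul]
      congr 2
      refine Finset.sum_congr rfl fun i hi => ?_
      have := Finset.mem_range.1 hi
      rw [hg i (by omega), hg _ (by omega)]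
      congr 3
      omega
    rw [narayanaTable, forceNat_eq, List.length_map, List.length_range, Nat.add_sub_cancel, ← hnew]
    have := ih (n + 1)
    rw [List.range_succ, List.map_append, List.map_singleton] at this
    rw [this]
    congr 2
    omega

end

/-! ### Correctness of the computation. -/

section

theorem coeff_cutShift {R : Type*} [CommSemiring R] (a k : ℕ) (p : R[X]) :
    (cutShift a p).coeff k = if a = 0 then p.coeff k else p.coeff k + p.coeff (k + 1) := by
  unfold cutShift
  split_ifs
  · rfl
  · rw [coeff_divX, add_mul, one_mul, coeff_add, coeff_X_mul, add_comm]

/-- The coefficient of `X ^ k` in `sortSeries l m`, as a function of `l`. -/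
noncomputable def sortCoeff (T m k l : ℕ) : ℕ := (sortSeries 1 0 T l m).coeff k

/-- The coefficients of the quotient of `sortSeries l (m + 1)` by `1 + X`. -/
noncomputable def sortCoeffAux (T m k l : ℕ) : ℕ :=
  sortCoeff T m k (l + 1) + T * ∑ a ∈ Finset.range m, ∑ i ∈ Finset.range (k + 1),
    ∑ j ∈ Finset.range l, sortCoeff T a i (l - j) *
      if a = 0 then sortCoeff T (m - a) (k - i) j
      else sortCoeff T (m - a) (k - i) j + sortCoeff T (m - a) (k - i + 1) j

theorem sortCoeff_succ (T m k l : ℕ) : sortCoeff T (m + 1) k l =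
    sortCoeffAux T m k l + if k = 0 then 0 else sortCoeffAux T m (k - 1) l := by
  have h : ∀ k, (sortSeries 1 0 T (l + 1) m + C T * ∑ a ∈ Finset.range m, ∑ j ∈ Finset.range l,
      sortSeries 1 0 T (l - j) a * cutShift a (sortSeries 1 0 T j (m - a))).coeff k =
      sortCoeffAux T m k l := by
    intro k
    rw [coeff_add, coeff_C_mul, finsetSum_coeff, sortCoeffAux, sortCoeff]
    congr 2
    refine Finset.sum_congr rfl fun a _ => ?_
    rw [finsetSum_coeff, Finset.sum_comm]
    refine Finset.sum_congr rfl fun j _ => ?_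
    rw [coeff_mul, Finset.Nat.sum_antidiagonal_eq_sum_range_succ_mk]
    refine Finset.sum_congr rfl fun i _ => ?_
    rw [coeff_cutShift]
    rfl
  rw [sortCoeff, sortSeries_succ, add_mul, one_mul, coeff_add, h]
  congr 1
  cases k with
  | zero => simp
  | succ k => rw [coeff_X_mul, h]; simp

/-- The state of the computation after row `m`. -/
structure RowState (T Z N m : ℕ) (row : List ℕ) (us ds : List (List ℕ)) : Prop where
  -- The known coefficients are those with `m + 2 * k + l ≤ N`. The recurrence respects this region:
  -- `cutShift` raises `k` by one only for `a ≥ 1`, where both the row index and the run length have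
  -- dropped.
  row_packs : ∀ k, m + 2 * k ≤ N → Packs Z (N - m - 2 * k + 1) (row.getD k 0) (sortCoeff T m k)
  us_length : us.length = m
  us_packs : ∀ a < m, ∀ k, a + 2 * k ≤ N →
    Packs Z (N - a - 2 * k) ((us.getD a []).getD k 0) fun l => sortCoeff T a k (l + 1)
  ds_length : ds.length = m
  -- The shifted rows are stored newest first, so entry `a` of `row :: ds` is the row `m - a` after
  -- `cutShift a`, facing row `a` in `us`.
  ds_packs : ∀ i < m, ∀ k, m - 1 - i + 2 * k + 2 ≤ N →
    Packs Z (N - (m - 1 - i) - 2 * k - 1) ((ds.getD i []).getD k 0)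
      fun l => sortCoeff T (m - 1 - i) k l + sortCoeff T (m - 1 - i) (k + 1) l

section
variable {T Z N m : ℕ} {row : List ℕ} {us ds : List (List ℕ)}

theorem RowState.packs_aux (h : RowState T Z N m row us ds)
    (hZ : ∀ m ≤ N, ∀ k, sortCoeff T m k 0 < Z) (k : ℕ) (hk : m + 1 + 2 * k ≤ N) :
    Packs Z (N - m - 2 * k) (row.getD k 0 / Z + T * Z * convSum k us (row :: ds))
      (sortCoeffAux T m k) := by
  have h1 := (h.row_packs k (by omega)).div_base (hZ m (by omega) k)
  refine h1.add ?_
  obtain ⟨L, hL⟩ : ∃ L, N - m - 2 * k = L + 1 := ⟨N - m - 2 * k - 1, by omega⟩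
  rw [mul_assoc]
  refine Packs.const_mul T ?_
  rw [convSum_eq _ _ _ (by simp [h.us_length, h.ds_length]), h.us_length, hL]
  have h2 : ∀ a ∈ Finset.range m,
      Packs Z L (convCoeff k (us.getD a []) ((row :: ds).getD a [])) fun l =>
      ∑ i ∈ Finset.range (k + 1), ∑ j ∈ Finset.range (l + 1), sortCoeff T a i (l + 1 - j) *
        if a = 0 then sortCoeff T (m - a) (k - i) j
        else sortCoeff T (m - a) (k - i) j + sortCoeff T (m - a) (k - i + 1) j := by
    intro a ha
    have ha := Finset.mem_range.1 ha
    rw [convCoeff_eq]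
    refine packs_sum _ _ _ fun i hi => ?_
    have hi := Finset.mem_range.1 hi
    have hu := (h.us_packs a ha i (by omega)).mono (L' := L) (by omega)
    have hv : Packs Z L (((row :: ds).getD a []).getD (k - i) 0) fun j =>
        if a = 0 then sortCoeff T (m - a) (k - i) j
        else sortCoeff T (m - a) (k - i) j + sortCoeff T (m - a) (k - i + 1) j := by
      cases a with
      | zero =>
        simpa using (h.row_packs (k - i) (by omega)).mono (L' := L) (by omega)
      | succ a =>
        have := (h.ds_packs a (by omega) (k - i) (by omega)).mono (L' := L) (by omega)
        have e : m - 1 - a = m - (a + 1) := by omega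
        rw [e] at this
        simpa using this
    refine (hu.mul hv).congr fun l hl => ?_
    -- The product is indexed by the left factor, the recurrence by the run length `j` of the right
    -- one.
    rw [← Finset.sum_range_reflect]
    refine Finset.sum_congr rfl fun j hj => ?_
    have hj := Finset.mem_range.1 hj
    have e1 : l + 1 - 1 - j + 1 = l + 1 - j := by omega
    have e2 : l - (l + 1 - 1 - j) = j := by omega
    rw [e1, e2]
  refine (packs_sum _ _ _ h2).base_mul.congr fun l _ => ?_
  cases l with
  | zero => simp
  | succ l => simp

theorem RowState.newRow_packs (h : RowState T Z N m row us ds)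
    (hZ : ∀ m ≤ N, ∀ k, sortCoeff T m k 0 < Z) (k : ℕ) (hk : m + 1 + 2 * k ≤ N) :
    Packs Z (N - (m + 1) - 2 * k + 1) ((newRow T Z N m row us (row :: ds)).getD k 0)
      (sortCoeff T (m + 1) k) := by
  have hget : ∀ k, m + 1 + 2 * k ≤ N → ((List.range ((N - (m + 1)) / 2 + 1)).map fun k =>
      row.getD k 0 / Z + T * Z * convSum k us (row :: ds)).getD k 0 =
      row.getD k 0 / Z + T * Z * convSum k us (row :: ds) := by
    intro k hk
    rw [List.getD_eq_getElem _ _ (by simp; omega)]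
    simp
  have e : N - (m + 1) - 2 * k + 1 = N - m - 2 * k := by omega
  rw [newRow, forceList_eq, getD_modRow, getD_mulOneAddX _ _ _ (by simp; omega), e, hget k hk]
  refine Packs.mod ?_
  refine Packs.congr ((h.packs_aux hZ k hk).add
    (f' := fun l => if k = 0 then 0 else sortCoeffAux T m (k - 1) l) ?_)
    fun l _ => (sortCoeff_succ T m k l).symm
  cases k with
  | zero => simpa using packs_zero
  | succ k =>
    simp only [Nat.add_one_ne_zero, if_false, Nat.add_sub_cancel]
    rw [hget k (by omega)]
    exact (h.packs_aux hZ k (by omega)).mono (by omega)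

theorem RowState.succ (h : RowState T Z N m row us ds)
    (hZ : ∀ m ≤ N, ∀ k, sortCoeff T m k 0 < Z) (hm : m + 1 ≤ N) :
    RowState T Z N (m + 1) (newRow T Z N m row us (row :: ds)) (us ++ [row.map (· / Z)])
      (shiftRow row :: ds) where
  row_packs k hk := h.newRow_packs hZ k hk
  us_length := by simp [h.us_length]
  us_packs a ha k hk := by
    rcases Nat.lt_or_ge a m with hlt | hge
    · rw [List.getD_append _ _ _ _ (by rw [h.us_length]; exact hlt)]
      exact h.us_packs a hlt k hk
    · obtain rfl : a = m := by omega
      rw [List.getD_append_right _ _ _ _ (by rw [h.us_length]), h.us_length, Nat.sub_self,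
        List.getD_cons_zero]
      have e : (row.map (· / Z)).getD k 0 = row.getD k 0 / Z := by
        have := List.getD_map (l := row) (d := 0) (n := k) (f := (· / Z))
        simpa using this
      rw [e]
      exact (h.row_packs k hk).div_base (hZ a (by omega) k)
  ds_length := by simp [h.ds_length]
  ds_packs i hi k hk := by
    cases i with
    | zero =>
      simp only [Nat.add_sub_cancel, Nat.sub_zero, List.getD_cons_zero, getD_shiftRow] at hk ⊢
      exact ((h.row_packs k (by omega)).mono (by omega)).add
        ((h.row_packs (k + 1) (by omega)).mono (by omega))
    | succ i =>
      have e : m + 1 - 1 - (i + 1) = m - 1 - i := by omega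
      rw [e] at hk ⊢
      rw [List.getD_cons_succ]
      exact h.ds_packs i (by omega) k hk

theorem RowState.runRows_eq (h : RowState T Z N m row us ds)
    (hZ : ∀ m ≤ N, ∀ k, sortCoeff T m k 0 < Z) (fuel : ℕ) (hf : m + fuel ≤ N) :
    runRows T Z N fuel m row us ds =
      (List.range' (m + 1) fuel).map fun n => sortCoeff T n 0 0 := by
  induction fuel generalizing m row us ds with
  | zero => rfl
  | succ fuel ih =>
    have h' := h.succ hZ (by omega)
    rw [runRows, forceList_eq, forceList_eq, forceList_eq, forceSpine_eq, ih h' (by omega),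
      List.range'_succ, List.map_cons]
    congr 1
    have hh : ∀ w : List ℕ, w.headD 0 = w.getD 0 0 := fun w => by cases w <;> rfl
    rw [hh]
    exact (h'.row_packs 0 (by omega)).mod_base (hZ (m + 1) (by omega) 0)

end

theorem gammaValues_eq {S Z N : ℕ} (hS : 1 ≤ S) (hN : 1 ≤ N)
    (hZ : N.factorial * 8 ^ N * S ^ N < Z) :
    gammaValues (S ^ 2) Z N = (List.range' 1 N).map fun n => (gammaPoly n).eval (S ^ 2) := by
  have hZ' : ∀ m ≤ N, ∀ k, sortCoeff (S ^ 2) m k 0 < Z := fun m hm k =>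
    (coeff_sortSeries_le hS hm k).trans_lt hZ
  have hstate : RowState (S ^ 2) Z N 0
      [packDigits Z (1 :: narayanaTable (S ^ 2) (N - 1) [1])] [] [] := by
    refine ⟨fun k hk => ?_, rfl, by simp, rfl, by simp⟩
    have hq : ∀ l, sortCoeff (S ^ 2) 0 k l =
        if k = 0 then treeSum 1 0 (S ^ 2) (List.range' 1 l) else 0 := by
      intro l
      rw [sortCoeff, sortSeries_zero, coeff_C]
    cases k with
    | zero =>
      have htab := narayanaTable_eq (S ^ 2) (N - 1) 0
      simp only [zero_add, List.range_one, List.map_singleton, List.range'_one,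
        treeSum_singleton] at htab
      rw [htab, List.getD_cons_zero]
      refine (packs_packDigits Z _ _).congr fun l hl => ?_
      rw [hq, if_pos rfl]
      cases l with
      | zero => simp
      | succ l =>
        rw [List.getD_cons_succ, List.getD_eq_getElem _ _ (by simp; omega)]
        simp
    | succ k =>
      simp only [List.getD_cons_succ, List.getD_nil]
      exact packs_zero.congr fun l _ => by rw [hq, if_neg (by omega)]
  rw [gammaValues, forceNat_eq, forceNat_eq, forceNat_eq, hstate.runRows_eq hZ' N (by omega)]
  refine List.map_congr_left fun n _ => ?_
  have := aeval_gammaPoly (S ^ 2) n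
  rw [sortCoeff, ← sum_treeSum_eq_coeff, ← this, coe_aeval_eq_eval]

end

/-! ### Certifying negative roots by sign changes. -/

section

/-- The base `B` digits of `n`, most significant digit first, prepended to `acc`. -/
def digitsRev (B : ℕ) : ℕ → ℕ → List ℕ → List ℕ
  | 0, _, acc => acc
  | f + 1, n, acc => digitsRev B f (n / B) (n % B :: acc)

/-- Whether the polynomial with coefficients `l`, leading coefficient first, is positive
(`pos = true`) or negative at `- a / D`; to be called with `E = O = 0` and `w = 1`. -/
def hornerSign (D a : ℕ) (pos : Bool) : List ℕ → ℕ → ℕ → ℕ → Bool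
  | [], E, O, _ => bif pos then Nat.blt O E else Nat.blt E O
  | c :: l, E, O, w => hornerSign D a pos l (c * w + a * O) (a * E) (w * D)

/-- Whether there are `need` sign changes at points `- a' / D` of a fixed geometric progression
`a' > a`, the sign at the start being `s`. -/
def signScan (D : ℕ) (l : List ℕ) : ℕ → ℕ → Bool → ℕ → Bool
  | _, _, _, 0 => true
  | 0, _, _, _ + 1 => false
  | fuel + 1, a, s, need + 1 => forceNat (a + a / 8) fun a' =>
    bif hornerSign D a' (!s) l 0 0 1 then signScan D l fuel a' (!s) need
    else signScan D l fuel a' s (need + 1)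

/-- A test that the polynomial of degree at most `d` with value `n` at `B` has `d` negative
roots. -/
def rootCheck (B d n : ℕ) : Bool :=
  Nat.blt n (B ^ (d + 1)) && forceList (digitsRev B (d + 1) n []) fun l =>
    hornerSign (2 ^ 20) 0 true l 0 0 1 && signScan (2 ^ 20) l 300 8 true d

def rootCheckAll (B : ℕ) : ℕ → List ℕ → Bool
  | _, [] => true
  | n, x :: l => forceNat x (rootCheck B ((n - 1) / 2)) && rootCheckAll B (n + 1) l

theorem rootCheckAll_map {B : ℕ} {f : ℕ → ℕ} (N m : ℕ)
    (h : rootCheckAll B m ((List.range' m N).map f) = true) :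
    ∀ n, m ≤ n → n < m + N → rootCheck B ((n - 1) / 2) (f n) = true := by
  induction N generalizing m with
  | zero => intro n h1 h2; omega
  | succ N ih =>
    rw [List.range'_succ, List.map_cons, rootCheckAll, forceNat_eq, Bool.and_eq_true] at h
    intro n h1 h2
    rcases Nat.eq_or_lt_of_le h1 with rfl | h1
    · exact h.1
    · exact ih (m + 1) h.2 n h1 (by omega)

theorem coeff_mul_pow_le_eval (p : ℕ[X]) (B i : ℕ) : p.coeff i * B ^ i ≤ p.eval B := by
  rw [eval_eq_sum, Polynomial.sum]
  by_cases h : i ∈ p.support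
  · exact Finset.single_le_sum (f := fun i => p.coeff i * B ^ i) (fun _ _ => Nat.zero_le _) h
  · rw [notMem_support_iff.1 h, zero_mul]
    exact Nat.zero_le _

theorem natDegree_lt_of_eval_lt {p : ℕ[X]} {B f : ℕ} (hB : 1 ≤ B) (hf : 1 ≤ f)
    (h : p.eval B < B ^ f) : p.natDegree < f := by
  by_contra! hc
  have h0 : p ≠ 0 := by
    rintro rfl
    simp at hc
    omega
  have h1 := coeff_mul_pow_le_eval p B p.natDegree
  have h2 : 1 ≤ p.coeff p.natDegree :=
    Nat.one_le_iff_ne_zero.2 (by simpa using h0)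
  have h3 : B ^ f ≤ B ^ p.natDegree := Nat.pow_le_pow_right hB hc
  have h4 := Nat.mul_le_mul h2 h3
  omega

/-- The bound on `p.eval 1` makes every coefficient smaller than `B`, so the base-`B` digits of
`p.eval B` are the coefficients, and the fold is Horner's rule. -/
theorem foldl_digitsRev (q : ℝ) {B : ℕ} (f : ℕ) (p : ℕ[X]) (acc : List ℕ) (h1 : p.eval 1 < B)
    (h : p.eval B < B ^ f) :
    (digitsRev B f (p.eval B) acc).foldl (fun v (c : ℕ) => v * q + (c : ℝ)) 0 =
      acc.foldl (fun v (c : ℕ) => v * q + (c : ℝ)) (aeval q p) := by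
  induction f generalizing p acc with
  | zero =>
    have hp : p = 0 := by
      ext i
      have h2 := coeff_mul_pow_le_eval p B i
      have h3 : B ^ i ≠ 0 := pow_ne_zero _ (by omega)
      rw [pow_zero, Nat.lt_one_iff] at h
      rw [h, Nat.le_zero, mul_eq_zero] at h2
      simpa using h2.resolve_right h3
    simp [digitsRev, hp]
  | succ f ih =>
    have e := X_mul_divX_add p
    have e1 : p.eval 1 = p.divX.eval 1 + p.coeff 0 := by
      conv_lhs => rw [← e]
      simp
    have e2 : p.eval B = B * p.divX.eval B + p.coeff 0 := by
      conv_lhs => rw [← e]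
      simp
    have e3 : p.eval B / B = p.divX.eval B := by
      rw [e2, Nat.mul_add_div (by omega), Nat.div_eq_of_lt (by omega), add_zero]
    have e4 : p.eval B % B = p.coeff 0 := by
      rw [e2, Nat.mul_add_mod, Nat.mod_eq_of_lt (by omega)]
    rw [digitsRev, e3, e4, ih _ _ (by omega) ?_, List.foldl_cons]
    · congr 1
      conv_rhs => rw [← e]
      simp [mul_comm]
    · rw [← e3]
      exact Nat.div_lt_of_lt_mul (by rwa [pow_succ'] at h)

/-- Horner's rule without denominators or subtraction: `E - O` is the current value scaled by `w /
D`, with `w` a power of `D`. Multiplying by `- a / D` exchanges the roles of `E` and `O`. -/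
theorem hornerSign_spec {D a : ℕ} (hD : 0 < D) (pos : Bool) (l : List ℕ) (E O w : ℕ) (hw : 0 < w)
    (v : ℝ) (hv : ((E : ℝ) - O) * D = v * w) (h : hornerSign D a pos l E O w = true) :
    0 < (if pos then 1 else -1) * l.foldl (fun v (c : ℕ) => v * (-(a : ℝ) / D) + (c : ℝ)) v := by
  have hD' : (0 : ℝ) < D := by exact_mod_cast hD
  induction l generalizing E O w v with
  | nil =>
    have hw' : (0 : ℝ) < w := by exact_mod_cast hw
    rw [List.foldl_nil]
    have hv' : v = ((E : ℝ) - O) * D / w := by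
      field_simp
      linarith
    cases pos with
    | true =>
      have : O < E := by simpa [hornerSign, Nat.blt_eq] using h
      have : (O : ℝ) < E := by exact_mod_cast this
      have : 0 < v := by
        rw [hv']
        exact div_pos (mul_pos (by linarith) hD') hw'
      simpa using this
    | false =>
      have : E < O := by simpa [hornerSign, Nat.blt_eq] using h
      have : (E : ℝ) < O := by exact_mod_cast this
      have : v < 0 := by
        rw [hv']
        exact div_neg_of_neg_of_pos (mul_neg_of_neg_of_pos (by linarith) hD') hw'
      simpa using this
  | cons c l ih =>
    rw [List.foldl_cons]
    rw [hornerSign] at h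
    refine ih _ _ _ (Nat.mul_pos hw hD) _ ?_ h
    push_cast
    field_simp
    linear_combination (-(a : ℝ)) * hv

/-- The sign of `p` at `x` is that of `s`. -/
def HasSign (p : ℝ[X]) (s : Bool) (x : ℝ) : Prop := 0 < (if s then 1 else -1) * p.eval x

theorem HasSign.exists_root {p : ℝ[X]} {s : Bool} {x y : ℝ} (hxy : x ≤ y) (hy : HasSign p s y)
    (hx : HasSign p (!s) x) : ∃ r, x < r ∧ r < y ∧ p.eval r = 0 := by
  have hc : ContinuousOn (fun x => p.eval x) (Set.Icc x y) := p.continuous.continuousOn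
  unfold HasSign at hx hy
  cases s with
  | true =>
    simp only [Bool.not_true, if_true, Bool.false_eq_true, if_false] at hx hy
    obtain ⟨r, hr, h0⟩ := intermediate_value_Ioo hxy hc (show (0 : ℝ) ∈ Set.Ioo _ _ from
      ⟨by simpa using hx, by simpa using hy⟩)
    exact ⟨r, hr.1, hr.2, h0⟩
  | false =>
    simp only [Bool.not_false, if_true, Bool.false_eq_true, if_false] at hx hy
    obtain ⟨r, hr, h0⟩ := intermediate_value_Ioo' hxy hc (show (0 : ℝ) ∈ Set.Ioo _ _ from
      ⟨by simpa using hy, by simpa using hx⟩)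
    exact ⟨r, hr.1, hr.2, h0⟩

/-- Here `- b / D` is the last point with a certified sign, while `a` may have advanced past points
that were not certified. Each new root lies strictly to the right of the next certified point and
all later roots to its left, so the roots are distinct. -/
theorem signScan_spec {D : ℕ} (hD : 0 < D) {l : List ℕ} {p : ℝ[X]}
    (hp : ∀ x : ℝ, l.foldl (fun v (c : ℕ) => v * x + (c : ℝ)) 0 = p.eval x)
    (fuel a : ℕ) (s : Bool) (need : ℕ)
    (h : signScan D l fuel a s need = true) (b : ℕ) (hb : b ≤ a)
    (hs : HasSign p s (-(b : ℝ) / D)) :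
    ∃ R : Finset ℝ, R.card = need ∧ ∀ r ∈ R, r < -(b : ℝ) / D ∧ p.eval r = 0 := by
  have hD' : (0 : ℝ) < D := by exact_mod_cast hD
  induction fuel generalizing a s need b with
  | zero =>
    cases need with
    | zero => exact ⟨∅, by simp⟩
    | succ need => simp [signScan] at h
  | succ fuel ih =>
    cases need with
    | zero => exact ⟨∅, by simp⟩
    | succ need =>
      rw [signScan, forceNat_eq] at h
      cases hsign : hornerSign D (a + a / 8) (!s) l 0 0 1 with
      | false =>
        rw [hsign, cond_false] at h
        exact ih _ _ _ h b (by omega) hs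
      | true =>
        rw [hsign, cond_true] at h
        have hs' := hornerSign_spec hD (!s) l 0 0 1 one_pos 0 (by simp) hsign
        rw [hp] at hs'
        obtain ⟨R, hR, hR'⟩ := ih _ _ _ h _ le_rfl hs'
        have hle : -((a + a / 8 : ℕ) : ℝ) / D ≤ -(b : ℝ) / D := by
          have : (b : ℝ) ≤ ((a + a / 8 : ℕ) : ℝ) := by
            exact_mod_cast (by omega : b ≤ a + a / 8)
          gcongr
        obtain ⟨r, hr1, hr2, hr3⟩ := HasSign.exists_root hle hs hs'
        refine ⟨insert r R, ?_, fun u hu => ?_⟩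
        · rw [Finset.card_insert_of_notMem, hR]
          intro hr
          exact absurd (hR' r hr).1 (not_lt.2 hr1.le)
        · rcases Finset.mem_insert.1 hu with rfl | hu
          · exact ⟨hr2, hr3⟩
          · exact ⟨(hR' u hu).1.trans_le hle, (hR' u hu).2⟩

/-- The size test gives degree at most `d`, and `d` distinct negative roots then leave no room for
another complex root. -/
theorem rootCheck_spec {B d : ℕ} {p : ℕ[X]} (h1 : p.eval 1 < B)
    (h : rootCheck B d (p.eval B) = true) (z : ℂ) (hz : aeval z p = 0) :
    ∃ r : ℝ, r < 0 ∧ z = r := by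
  rw [rootCheck, forceList_eq, Bool.and_eq_true, Bool.and_eq_true, Nat.blt_eq] at h
  obtain ⟨hlt, hpos, hscan⟩ := h
  have hdeg := natDegree_lt_of_eval_lt (by omega) (by omega) hlt
  set P : ℝ[X] := p.map (Nat.castRingHom ℝ) with hP
  have hPe : ∀ x : ℝ, P.eval x = aeval x p := fun x => by
    rw [hP, eval_map, aeval_def]
    rfl
  have hl : ∀ x : ℝ, (digitsRev B (d + 1) (p.eval B) []).foldl
      (fun v (c : ℕ) => v * x + (c : ℝ)) 0 = P.eval x := fun x => by
    rw [foldl_digitsRev x (d + 1) p [] h1 hlt, List.foldl_nil, hPe]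
  have h0 := hornerSign_spec (D := 2 ^ 20) (a := 0) (by norm_num) true _ 0 0 1 one_pos 0
    (by simp) hpos
  rw [hl] at h0
  -- The positive sign is certified at `0`; the scan begins at `8`, the least `a` for which `a + a /
  -- 8` exceeds `a`.
  obtain ⟨R, hR, hR'⟩ := signScan_spec (by norm_num) hl 300 8 true d hscan 0 (by norm_num) h0
  have hP0 : P ≠ 0 := by
    intro hP0
    rw [hP0] at h0
    simp at h0
  set Q : ℂ[X] := P.map (algebraMap ℝ ℂ) with hQ
  have hQ0 : Q ≠ 0 := (Polynomial.map_ne_zero_iff (algebraMap ℝ ℂ).injective).2 hP0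
  have hQdeg : Q.natDegree ≤ d := by
    refine natDegree_map_le.trans (natDegree_map_le.trans ?_)
    omega
  have hsub : R.image (fun r : ℝ => (r : ℂ)) ⊆ Q.roots.toFinset := by
    intro u hu
    obtain ⟨r, hr, rfl⟩ := Finset.mem_image.1 hu
    rw [Multiset.mem_toFinset, mem_roots hQ0, IsRoot, hQ, eval_map_algebraMap]
    have := aeval_algebraMap_apply ℂ r P
    rw [show (r : ℂ) = algebraMap ℝ ℂ r from rfl, this, coe_aeval_eq_eval, (hR' r hr).2, map_zero]
  have hcard : Q.roots.toFinset.card ≤ (R.image (fun r : ℝ => (r : ℂ))).card := by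
    rw [Finset.card_image_of_injective _ Complex.ofReal_injective, hR]
    exact (Multiset.toFinset_card_le _).trans ((card_roots' Q).trans hQdeg)
  have heq := Finset.eq_of_subset_of_card_le hsub hcard
  have hzmem : z ∈ Q.roots.toFinset := by
    rw [Multiset.mem_toFinset, mem_roots hQ0, IsRoot, hQ, eval_map, hP, eval₂_map]
    rw [aeval_def] at hz
    rwa [Subsingleton.elim ((algebraMap ℝ ℂ).comp (Nat.castRingHom ℝ)) (algebraMap ℕ ℂ)]
  rw [← heq] at hzmem
  obtain ⟨r, hr, rfl⟩ := Finset.mem_image.1 hzmem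
  exact ⟨r, by simpa using (hR' r hr).1, rfl⟩

/-- The values at 1 are coefficient sums, so all coefficients are below the base `2 ^ 108` used for
reading digits. The packing base `2 ^ 310` exceeds `43! * 8 ^ 43`. -/
theorem gammaValues_one_lt :
    (gammaValues (1 ^ 2) (2 ^ 310) 43).all (fun v => Nat.blt v ((2 ^ 54) ^ 2)) = true := by
  decide +kernel

/-- The evaluation point equals the digit base, `2 ^ 108 = S ^ 2` with `S = 2 ^ 54`; the packing
base `2 ^ 2640` exceeds `43! * 8 ^ 43 * S ^ 43`. -/
theorem rootCheckAll_gammaValues :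
    rootCheckAll ((2 ^ 54) ^ 2) 1 (gammaValues ((2 ^ 54) ^ 2) (2 ^ 2640) 43) = true := by
  decide +kernel

end

/-! ### Conclusion: from the γ-polynomial back to the descent polynomial. -/

theorem gammaPoly_root_neg {n : ℕ} (hn1 : 1 ≤ n) (hn : n ≤ 43) {z : ℂ}
    (hz : aeval z (gammaPoly n) = 0) : ∃ r : ℝ, r < 0 ∧ z = r := by
  have h1 := gammaValues_one_lt
  have h2 := rootCheckAll_gammaValues
  rw [gammaValues_eq le_rfl (by norm_num) (by decide +kernel), List.all_eq_true] at h1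
  rw [gammaValues_eq (by norm_num) (by norm_num) (by decide +kernel)] at h2
  have h3 := h1 ((gammaPoly n).eval (1 ^ 2)) (List.mem_map_of_mem (by simp; omega))
  rw [Nat.blt_eq, one_pow] at h3
  exact rootCheck_spec h3 (rootCheckAll_map 43 1 h2 n hn1 (by omega)) z hz

/-- The substitution `t = z / (1 + z) ^ 2` takes only real `z` to negative reals. -/
theorem im_eq_zero_of_div_sq_neg {z : ℂ} (hz : 1 + z ≠ 0) {r : ℝ} (hr : r < 0)
    (h : z / (1 + z) ^ 2 = r) : z.im = 0 := by
  rw [div_eq_iff (pow_ne_zero 2 hz)] at h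
  have hre := congrArg Complex.re h
  have him := congrArg Complex.im h
  simp [pow_two] at hre him
  -- For nonreal `z` the imaginary part gives `2 * r * (1 + z.re) = 1`, hence `z.re < -1`; inserted
  -- into the real part it puts `z` on the unit circle, a contradiction.
  by_contra hv
  have h1 : 2 * r * (1 + z.re) = 1 := by
    have : z.im * (2 * r * (1 + z.re) - 1) = 0 := by linear_combination -him
    rcases mul_eq_zero.1 this with h | h
    · exact absurd h hv
    · linarith
  have h2 : r * (z.re ^ 2 + z.im ^ 2 - 1) = 0 := by
    linear_combination hre + (z.re) * h1
  have h3 : z.re ^ 2 + z.im ^ 2 = 1 := by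
    rcases mul_eq_zero.1 h2 with h | h
    · exact absurd h hr.ne
    · linarith
  nlinarith [sq_nonneg z.im, sq_nonneg (z.re + 1)]

theorem proposition1 (n : ℕ) (hn : n ≤ 43) : RealRooted (descentPoly 3 n) := by
  intro z hz
  rcases Nat.eq_zero_or_pos n with rfl | hn1
  · rw [aeval_descentPoly, stackSortable_two_zero] at hz
    simp at hz
  · by_cases hz1 : 1 + z = 0
    · rw [← neg_eq_iff_add_eq_zero.2 hz1]
      simp
    · rw [aeval_descentPoly_eq_gammaPoly n hn1 z hz1, mul_eq_zero] at hz
      obtain ⟨r, hr, h⟩ :=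
        gammaPoly_root_neg hn1 hn (hz.resolve_left (pow_ne_zero _ hz1))
      exact im_eq_zero_of_div_sq_neg hz1 hr h
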